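/- Let $p$ be a prime, $k$ an algebraically closed field of characteristic $p$, and $E\cong(\mathbb{Z}/p)^r$ an elementary abelian $p$-group of arbitrary rank $r$ with chosen generators $g_1,\dots,g_r$. Put $X_j=g_j-1\in kE$ and, for $\alpha=(\lambda_1,\dots,\lambda_r)\in k^r$, $X_\alpha=\lambda_1X_1+\cdots+\lambda_rX_r$. All modules are finite dimensional over $k$. A $kE$-module $M$ has constant Jordan type if the Jordan type of $X_\alpha$ acting on $M$ is the same for all non-zero $\alpha$. Let $\mathbb{P}^{r-1}=\operatorname{Proj}k[Y_1,\dots,Y_r]$ and $\widetilde M=M\otimes_k\mathcal{O}_{\mathbb{P}^{r-1}}$, and let $\theta_M\colon\widetilde M(n)\to\widetilde M(n+1)$ be given by $\theta_M(m\otimes f)=\sum_jX_jm\otimes Y_jf$. For $1\le i\le p$ let $$\mathcal{F}_i(M)=\frac{\operatorname{Ker}\theta_M\cap\operatorname{Im}\theta_M^{i-1}}{\operatorname{Ker}\theta_M\cap\operatorname{Im}\theta_M^{i}},$$ where $\operatorname{Ker}\theta_M$ is the kernel of $\widetilde M\to\widetilde M(1)$ and $\operatorname{Im}\theta_M^j$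 is the image of $\theta_M^j\colon\widetilde M(-j)\to\widetilde M$. For $n\ge1$ define the $n$th power generic kernel and the $n$th power generic image of a $kE$-module $M$ by $$\mathfrak{K}^n(M)=\bigcap_{U}\ \sum_{\overline\alpha\in U}\operatorname{Ker}(X_\alpha^n,M),\qquad \mathfrak{I}^n(M)=\bigcap_{\overline\alpha\in\mathbb{P}^{r-1}(k)}\operatorname{Im}(X_\alpha^n,M),$$ where $U$ runs over the dense Zariski open subsets of $\mathbb{P}^{r-1}(k)$; both are submodules of $M$. **Theorem.** Let $M$ be a $kE$-module of constant Jordan type, let $1\le i\le p$, and let $n,m\ge1$ satisfy $i\le\min\{n-1,m-1\}$. Then, as sheaves of $\mathcal{O}_{\mathbb{P}^{r-1}}$-modules, $$\mathcal{F}_i(M)\cong\mathcal{F}_i\bigl(\mathfrak{K}^n(M)/\mathfrak{I}^m\mathfrak{K}^n(M)\bigr)\qquad\text{and}\qquad\mathcal{F}_i(M)\cong\mathcal{F}_i\bigl(\mathfrak{K}^n(M/\mathfrak{I}^m(M))\bigr).$$ In particular, $$\mathcal{F}_i(M)\cong\mathcal{F}_i\bigl(\mathfrak{K}^{i+1}(M)/\mathfrak{I}^{i+1}\mathfrak{K}^{i+1}(M)\bigr)\qquad\text{and}\qquad\mathcal{F}_i(M)\cong\mathcal{F}_i\bigl(\mathfrak{K}^{i+1}(M/\mathfrak{I}^{i+1}(M))\bigr).$$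 -/

import Mathlib

open CategoryTheory CategoryTheory.Limits TopologicalSpace
open scoped TensorProduct

universe u v

noncomputable section

namespace GenericKernels

attribute [local instance] MvPolynomial.gradedAlgebra

/-! ### Projective space and the twisted free sheaves `M ⊗ 𝒪(n)` -/

section Sheaves

variable (k : Type u) [Field k] (r : ℕ)

/-- The homogeneous coordinate ring `k[Y₁, …, Yᵣ]`. -/
abbrev S : Type u := MvPolynomial (Fin r) k

/-- The standard grading of `k[Y₁, …, Yᵣ]`. -/
abbrev grading : ℕ → Submodule k (S k r) := MvPolynomial.homogeneousSubmodule (Fin r) k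

/-- The scheme `ℙ^{r-1} = Proj k[Y₁, …, Yᵣ]`. -/
abbrev PSpace : AlgebraicGeometry.Scheme.{u} := AlgebraicGeometry.Proj (grading k r)

/-- The underlying topological space of `Proj k[Y₁, …, Yᵣ]`. -/
abbrev PTop : TopCat.{u} := ProjectiveSpectrum.top (grading k r)

variable {k r}

instance (x : PTop k r) : Ideal.IsPrime
    (HomogeneousIdeal.toIdeal (ProjectiveSpectrum.asHomogeneousIdeal x)) :=
  ProjectiveSpectrum.isPrime x

/-- The localization of the polynomial ring at the homogeneous prime ideal `x`. -/
abbrev Loc (x : ProjectiveSpectrum (grading k r)) : Type u :=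
  Localization.AtPrime x.asHomogeneousIdeal.toIdeal

variable (M : Type u) [AddCommGroup M] [Module k M]

/-- `S_x ⊗ M`; for every `n` the stalk of `M ⊗ 𝒪(n)` at `x` is its part of degree `n`. -/
abbrev Fib (x : ProjectiveSpectrum (grading k r)) : Type u := Loc x ⊗[k] M

/-- The part `S_a ⊗ M` of degree `a` of the graded module `S ⊗ M`. -/
def homPart (a : ℕ) : Submodule k (S k r ⊗[k] M) :=
  LinearMap.range (LinearMap.rTensor M (grading k r a).subtype)

/-- The localization map `S ⊗ M → S_x ⊗ M`. -/
def toFib (x : ProjectiveSpectrum (grading k r)) : S k r ⊗[k] M →ₗ[S k r] Fib M x :=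
  TensorProduct.AlgebraTensorModule.map (Algebra.linearMap (S k r) (Loc x)) LinearMap.id

/-- `s = t / g` on all of `U`, where `t ∈ S_a ⊗ M` and `g ∈ S_b` are homogeneous with
`a = b + n`, and `g` vanishes nowhere on `U`. -/
def IsFractionOfDegree (n : ℤ) {U : Opens (PTop k r)} (s : ∀ x : U, Fib M x.1) : Prop :=
  ∃ (a b : ℕ) (t : S k r ⊗[k] M) (g : S k r),
    (a : ℤ) = b + n ∧ t ∈ homPart M a ∧ g ∈ grading k r b ∧
      ∀ x : U, g ∉ x.1.asHomogeneousIdeal ∧ g • s x = toFib M x.1 t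

/-- Being a fraction of degree `n` passes to smaller open sets. -/
def fractionPrelocal (n : ℤ) : TopCat.PrelocalPredicate (fun x : PTop k r => Fib M x) where
  pred {_} s := IsFractionOfDegree M n s
  res := by
    rintro V U i s ⟨a, b, t, g, hab, ht, hg, h⟩
    exact ⟨a, b, t, g, hab, ht, hg, fun x => h (i x)⟩

/-- Being locally a fraction of degree `n`. -/
def locallyFraction (n : ℤ) : TopCat.LocalPredicate (fun x : PTop k r => Fib M x) :=
  (fractionPrelocal M n).sheafify

/-- The sheaf of sets underlying `M ⊗ 𝒪(n)`. -/
def twistInType (n : ℤ) : TopCat.Sheaf (Type u) (PTop k r) :=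
  TopCat.subsheafToTypes (locallyFraction M n)

variable {M}

theorem smul_mem_homPart {a b : ℕ} {g : S k r} (hg : g ∈ grading k r b)
    {t : S k r ⊗[k] M} (ht : t ∈ homPart M a) : g • t ∈ homPart M (b + a) := by
  obtain ⟨t, rfl⟩ := ht
  induction t with
  | zero => simp
  | add x y hx hy => rw [map_add, smul_add]; exact add_mem hx hy
  | tmul f m =>
    refine ⟨⟨g * f.1, SetLike.mul_mem_graded hg f.2⟩ ⊗ₜ m, ?_⟩
    simp [TensorProduct.smul_tmul']

theorem add_pred {n : ℤ} {U : Opens (PTop k r)} {s s' : ∀ x : U, Fib M x.1}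
    (hs : (locallyFraction M n).pred s) (hs' : (locallyFraction M n).pred s') :
    (locallyFraction M n).pred (s + s') := by
  intro x
  obtain ⟨V, hV, i, a, b, t, g, hab, ht, hg, h⟩ := hs x
  obtain ⟨V', hV', i', a', b', t', g', hab', ht', hg', h'⟩ := hs' x
  refine ⟨V ⊓ V', ⟨hV, hV'⟩, Opens.infLELeft _ _ ≫ i, b' + a, b + b', g' • t + g • t', g * g',
    by push_cast; omega, add_mem (smul_mem_homPart hg' ht) ?_, SetLike.mul_mem_graded hg hg', ?_⟩
  · have : b' + a = b + a' := by omega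
    rw [this]
    exact smul_mem_homPart hg ht'
  · rintro ⟨y, hy⟩
    obtain ⟨h1, h2⟩ := h ⟨y, hy.1⟩
    obtain ⟨h1', h2'⟩ := h' ⟨y, hy.2⟩
    refine ⟨y.asHomogeneousIdeal.toIdeal.primeCompl.mul_mem h1 h1', ?_⟩
    rw [map_add, map_smul, map_smul, ← h2, ← h2']
    change (g * g') • (s _ + s' _) = _
    rw [smul_add, mul_comm g g', mul_smul, mul_comm g' g, mul_smul]
    rfl

theorem exists_homogeneous_notMem (x : PTop k r) :
    ∃ (m : ℕ) (f : S k r), f ∈ grading k r m ∧ 0 < m ∧ f ∉ x.asHomogeneousIdeal := by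
  classical
  by_contra! h
  refine x.not_irrelevant_le fun z hz => ?_
  rw [← DirectSum.sum_support_decompose (grading k r) z]
  refine x.asHomogeneousIdeal.toIdeal.sum_mem fun d hd => ?_
  refine h d _ (SetLike.coe_mem _) (Nat.pos_of_ne_zero ?_)
  rintro rfl
  rw [DFinsupp.mem_support_iff] at hd
  exact hd (Subtype.ext hz)

theorem zero_pred {n : ℤ} {U : Opens (PTop k r)} :
    (locallyFraction M n).pred (0 : ∀ x : U, Fib M x.1) := by
  intro x
  obtain ⟨m, f, hf, hm, hfx⟩ := exists_homogeneous_notMem x.1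
  refine ⟨U ⊓ ProjectiveSpectrum.basicOpen _ f, ⟨x.2, hfx⟩, Opens.infLELeft _ _,
    (m * n.natAbs + n).toNat, n.natAbs * m, 0, f ^ n.natAbs, ?_, zero_mem _,
    SetLike.pow_mem_graded n.natAbs hf, ?_⟩
  · have h1 : (n.natAbs : ℤ) ≤ m * n.natAbs := by
      have : (1 : ℤ) ≤ m := by exact_mod_cast hm
      nlinarith [Int.natCast_nonneg n.natAbs]
    rw [Int.toNat_of_nonneg (by omega)]
    push_cast
    ring
  · rintro ⟨y, hy⟩
    refine ⟨fun h => hy.2 (y.isPrime.mem_of_pow_mem _ h), ?_⟩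
    rw [map_zero]
    exact smul_zero _

theorem neg_pred {n : ℤ} {U : Opens (PTop k r)} {s : ∀ x : U, Fib M x.1}
    (hs : (locallyFraction M n).pred s) : (locallyFraction M n).pred (-s) := by
  intro x
  obtain ⟨V, hV, i, a, b, t, g, hab, ht, hg, h⟩ := hs x
  refine ⟨V, hV, i, a, b, -t, g, hab, neg_mem ht, hg, fun y => ⟨(h y).1, ?_⟩⟩
  rw [map_neg, ← (h y).2]
  exact smul_neg g (s (i y))

variable (M) in
/-- The sections of `M ⊗ 𝒪(n)` over `U`, as a group of functions on `U`. -/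
def sections (n : ℤ) (U : Opens (PTop k r)) : AddSubgroup (∀ x : U, Fib M x.1) where
  carrier := {s | (locallyFraction M n).pred s}
  zero_mem' := zero_pred
  add_mem' := add_pred
  neg_mem' := neg_pred

theorem smul_pred {n : ℤ} {U : Opens (PTop k r)}
    (c : (AlgebraicGeometry.ProjectiveSpectrum.Proj.structureSheaf (grading k r)).1.obj (.op U))
    {s : ∀ x : U, Fib M x.1} (hs : (locallyFraction M n).pred s) :
    (locallyFraction M n).pred (fun x => (c.1 x).val • s x) := by
  intro x
  obtain ⟨V, hV, i, a, b, t, g, hab, ht, hg, h⟩ := hs x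
  obtain ⟨V', hV', i', d, f, e, he, h'⟩ := c.2 x
  refine ⟨V ⊓ V', ⟨hV, hV'⟩, Opens.infLELeft _ _ ≫ i, d + a, d + b, f.1 • t, e.1 * g,
    by push_cast; omega, smul_mem_homPart f.2 ht, SetLike.mul_mem_graded e.2 hg, ?_⟩
  rintro ⟨y, hy⟩
  obtain ⟨h1, h2⟩ := h ⟨y, hy.1⟩
  refine ⟨y.asHomogeneousIdeal.toIdeal.primeCompl.mul_mem (he ⟨y, hy.2⟩) h1, ?_⟩
  have h3 : (c.1 ⟨y, i'.le hy.2⟩).val = Localization.mk f.1 ⟨e.1, he ⟨y, hy.2⟩⟩ :=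
    congrArg HomogeneousLocalization.val (h' ⟨y, hy.2⟩)
  have h4 : e.1 • (c.1 ⟨y, i'.le hy.2⟩).val = algebraMap (S k r) (Loc y) f.1 := by
    rw [h3, Localization.mk_eq_mk', Algebra.smul_def]
    exact IsLocalization.mk'_spec' (Loc y) f.1 ⟨e.1, he ⟨y, hy.2⟩⟩
  rw [map_smul, ← h2]
  change (e.1 * g) • ((c.1 ⟨y, i'.le hy.2⟩).val • s ⟨y, i.le hy.1⟩) = f.1 • g • s ⟨y, i.le hy.1⟩
  rw [mul_comm, mul_smul, ← smul_assoc e.1, h4, algebraMap_smul, smul_comm]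

variable (M)

instance (n : ℤ) (U : (Opens (PTop k r))ᵒᵖ) : AddCommGroup ((twistInType M n).1.obj U) :=
  inferInstanceAs (AddCommGroup (sections M n U.unop))

/-- The action of functions on sections is pointwise. -/
instance (n : ℤ) (U : (Opens (PTop k r))ᵒᵖ) :
    Module ((AlgebraicGeometry.ProjectiveSpectrum.Proj.structureSheaf (grading k r)).1.obj U)
      ((twistInType M n).1.obj U) where
  smul c s := ⟨fun x => (c.1 x).val • s.1 x, smul_pred c s.2⟩
  one_smul s := Subtype.ext <| funext fun x => by
    change ((1 : HomogeneousLocalization.AtPrime _ _)).val • s.1 x = _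
    rw [HomogeneousLocalization.val_one, one_smul]
  mul_smul c d s := Subtype.ext <| funext fun x => by
    change (c.1 x * d.1 x).val • s.1 x = (c.1 x).val • (d.1 x).val • s.1 x
    rw [HomogeneousLocalization.val_mul, mul_smul]
  smul_zero c := Subtype.ext <| funext fun x => smul_zero _
  smul_add c s t := Subtype.ext <| funext fun x => smul_add _ _ _
  add_smul c d s := Subtype.ext <| funext fun x => by
    change (c.1 x + d.1 x).val • s.1 x = (c.1 x).val • s.1 x + (d.1 x).val • s.1 x
    rw [HomogeneousLocalization.val_add, add_smul]
  zero_smul s := Subtype.ext <| funext fun x => by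
    change (0 : HomogeneousLocalization.AtPrime _ _).val • s.1 x = 0
    rw [HomogeneousLocalization.val_zero, zero_smul]

/-- The presheaf of abelian groups underlying `M ⊗ 𝒪(n)`. -/
def twistAb (n : ℤ) : (Opens (PTop k r))ᵒᵖ ⥤ Ab.{u} where
  obj U := AddCommGrpCat.of ((twistInType M n).1.obj U)
  map i := AddCommGrpCat.ofHom
    { toFun := (twistInType M n).1.map i
      map_zero' := rfl
      map_add' := fun _ _ => rfl }

instance twistModule (n : ℤ) (U : (Opens (PTop k r))ᵒᵖ) :
    Module ((PSpace k r).ringCatSheaf.obj.obj U) ((twistAb M n).obj U) :=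
  inferInstanceAs (Module
    ((AlgebraicGeometry.ProjectiveSpectrum.Proj.structureSheaf (grading k r)).1.obj U)
    ((twistInType M n).1.obj U))

/-- `M ⊗ 𝒪(n)` as a presheaf of modules. -/
def twistPresheaf (n : ℤ) : (PSpace k r).PresheafOfModules :=
  @PresheafOfModules.ofPresheaf _ _ (PSpace k r).ringCatSheaf.obj (twistAb M n)
    (fun U => twistModule M n U) (fun _ _ _ _ _ => rfl)

/-- The sheaf of modules `M ⊗ 𝒪(n)` on `ℙ^{r-1}`. -/
def twist (n : ℤ) : (PSpace k r).Modules where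
  val := twistPresheaf M n
  isSheaf := (TopCat.Presheaf.isSheaf_iff_isSheaf_comp (forget AddCommGrpCat) _).2
    (twistInType M n).2

/-! ### The operator `θ` -/

variable {M} (A : Fin r → Module.End k M)

/-- The operator `∑ⱼ Yⱼ ⊗ Aⱼ` on `S ⊗ M`. -/
def polyTheta : Module.End (S k r) (S k r ⊗[k] M) :=
  ∑ j, (MvPolynomial.X j : S k r) • LinearMap.baseChange (S k r) (A j)

/-- The operator `∑ⱼ Yⱼ ⊗ Aⱼ` on `S_x ⊗ M`. -/
def fibTheta (x : ProjectiveSpectrum (grading k r)) : Module.End (Loc x) (Fib M x) :=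
  ∑ j, algebraMap (S k r) (Loc x) (MvPolynomial.X j) • LinearMap.baseChange (Loc x) (A j)

theorem toFib_polyTheta (x : ProjectiveSpectrum (grading k r)) (t : S k r ⊗[k] M) :
    toFib M x (polyTheta A t) = fibTheta A x (toFib M x t) := by
  induction t with
  | zero => simp
  | add t t' h h' => rw [map_add, map_add, map_add, map_add, h, h']
  | tmul f m =>
    simp [polyTheta, fibTheta, toFib, TensorProduct.smul_tmul', Algebra.smul_def]

theorem polyTheta_mem {a : ℕ} {t : S k r ⊗[k] M} (ht : t ∈ homPart M a) :
    polyTheta A t ∈ homPart M (a + 1) := by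
  simp only [polyTheta, LinearMap.sum_apply, LinearMap.smul_apply]
  refine sum_mem fun j _ => ?_
  rw [add_comm]
  refine smul_mem_homPart (MvPolynomial.isHomogeneous_X k j) ?_
  obtain ⟨t, rfl⟩ := ht
  refine ⟨LinearMap.lTensor _ (A j) t, ?_⟩
  induction t with
  | zero => simp
  | add x y hx hy => rw [map_add, map_add, map_add, map_add, hx, hy]
  | tmul f m => simp

theorem fibTheta_pred {n : ℤ} {U : Opens (PTop k r)} {s : ∀ x : U, Fib M x.1}
    (hs : (locallyFraction M n).pred s) :
    (locallyFraction M (n + 1)).pred (fun x => fibTheta A x.1 (s x)) := by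
  intro x
  obtain ⟨V, hV, i, a, b, t, g, hab, ht, hg, h⟩ := hs x
  refine ⟨V, hV, i, a + 1, b, polyTheta A t, g, by push_cast; omega, polyTheta_mem A ht, hg,
    fun y => ⟨(h y).1, ?_⟩⟩
  refine Eq.trans ?_ (toFib_polyTheta A y.1 t).symm
  refine Eq.trans ?_ (congrArg (fibTheta A y.1) (h y).2)
  exact ((fibTheta A y.1).map_smul_of_tower g (s (i y))).symm

theorem fibTheta_pow_pred (j : ℕ) {n n' : ℤ} (h : n + j = n') {U : Opens (PTop k r)}
    {s : ∀ x : U, Fib M x.1} (hs : (locallyFraction M n).pred s) :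
    (locallyFraction M n').pred (fun x => (fibTheta A x.1 ^ j) (s x)) := by
  induction j generalizing n' with
  | zero =>
    obtain rfl : n = n' := by simpa using h
    exact hs
  | succ j ih =>
    obtain rfl : n + j + 1 = n' := by rw [← h]; push_cast; ring
    have := fibTheta_pred A (ih rfl)
    simpa only [pow_succ', Module.End.mul_apply] using this

/-- The morphism `θ^j : M ⊗ 𝒪(n) → M ⊗ 𝒪(n')`, `n' = n + j`, where
`θ (m ⊗ f) = ∑ᵢ Aᵢ m ⊗ Yᵢ f`. -/
def thetaPow (j : ℕ) (n n' : ℤ) (h : n + j = n') :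
    (twist M n : (PSpace k r).Modules) ⟶ twist M n' where
  val :=
    { app := fun U => ModuleCat.ofHom (X := (twistPresheaf M n).obj U)
        (Y := (twistPresheaf M n').obj U)
        { toFun := fun s => (⟨fun x => (fibTheta A x.1 ^ j) (s.1 x),
            fibTheta_pow_pred A j h s.2⟩ : (twistInType M n').1.obj U)
          map_add' := fun _ _ => Subtype.ext <| funext fun _ => map_add _ _ _
          map_smul' := fun _ _ => Subtype.ext <| funext fun x =>
            (fibTheta A x.1 ^ j).map_smul _ _ }
      naturality := fun _ => rfl }

theorem thetaPow_zero (n : ℤ) : thetaPow A 0 n n (by simp) = 𝟙 (twist M n) := rfl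

theorem thetaPow_comp (i j : ℕ) (n n' n'' : ℤ) (h : n + i = n') (h' : n' + j = n'') :
    thetaPow A i n n' h ≫ thetaPow A j n' n'' h' =
      thetaPow A (i + j) n n'' (by rw [← h', ← h]; push_cast; ring) := by
  refine AlgebraicGeometry.Scheme.Modules.hom_ext _ _ fun U => ?_
  refine ConcreteCategory.hom_ext _ _ fun s => Subtype.ext <| funext fun x => ?_
  change (fibTheta A x.1 ^ j) ((fibTheta A x.1 ^ i) (s.1 x)) = (fibTheta A x.1 ^ (i + j)) (s.1 x)
  rw [add_comm, pow_add]
  rfl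

/-- `Ker θ ⊆ M ⊗ 𝒪`, for `θ : M ⊗ 𝒪 → M ⊗ 𝒪(1)`. -/
def kerTheta : Subobject (twist M 0 : (PSpace k r).Modules) :=
  kernelSubobject (thetaPow A 1 0 1 rfl)

/-- `Img θ^j ⊆ M ⊗ 𝒪`, for `θ^j : M ⊗ 𝒪(-j) → M ⊗ 𝒪`. -/
def imTheta (j : ℕ) : Subobject (twist M 0 : (PSpace k r).Modules) :=
  imageSubobject (thetaPow A j (-j) 0 (by simp))

theorem imTheta_antitone : Antitone (imTheta A) := by
  intro i j hij
  obtain ⟨l, rfl⟩ := Nat.exists_eq_add_of_le' hij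
  have h := imageSubobject_comp_le
    (thetaPow A l (-(l + i : ℕ)) (-i) (by push_cast; ring)) (thetaPow A i (-i) 0 (by simp))
  simp only [thetaPow_comp] at h
  exact h

/-- The sheaf `(Ker θ ∩ Img θ^{i-1}) / (Ker θ ∩ Img θ^i)` for `1 ≤ i`. -/
def subquotient (i : ℕ) : (PSpace k r).Modules :=
  cokernel (Subobject.ofLE (kerTheta A ⊓ imTheta A i) (kerTheta A ⊓ imTheta A (i - 1))
    (inf_le_inf_left _ (imTheta_antitone A (Nat.sub_le i 1))))

end Sheaves

/-! ### Modules over the group algebra of an elementary abelian group -/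

section GroupAlgebra

open scoped LinearAlgebra.Projectivization

variable {p : ℕ} {k : Type u} [Field k] {r : ℕ} {E : Type*} [CommGroup E]
  (e : E ≃* Multiplicative (Fin r → ZMod p))

/-- The `j`-th of the generators `g₁, …, gᵣ` of `E` given by the isomorphism `E ≃ (ℤ/p)^r`. -/
def gen (j : Fin r) : E := e.symm (Multiplicative.ofAdd (Pi.single j 1))

variable (k) in
/-- `Xⱼ = gⱼ - 1` in the group algebra `kE`. -/
def genX (j : Fin r) : MonoidAlgebra k E := MonoidAlgebra.of k E (gen e j) - 1

/-- `X_α = α₁ X₁ + ⋯ + αᵣ Xᵣ` in the group algebra `kE`. -/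
def XElt (α : Fin r → k) : MonoidAlgebra k E := ∑ j, α j • genX k e j

/-- The nilpotent endomorphism `f` has Jordan type `[p]^{a_p} ⋯ [1]^{a_1}`: there is a basis in
which it consists of `a_{j+1}` nilpotent Jordan blocks of length `j + 1`, for `0 ≤ j < p`
(here `a j` stands for `a_{j+1}`). -/
def HasJordanType {M : Type*} [AddCommGroup M] [Module k M] (f : Module.End k M)
    (a : Fin p → ℕ) : Prop :=
  ∃ b : Module.Basis (Σ j : Fin p, Fin (a j) × Fin (j + 1)) k M,
    ∀ (j : Fin p) (c : Fin (a j)) (s : Fin (j + 1)),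
      f (b ⟨j, c, s⟩) = if h : (s : ℕ) + 1 < j + 1 then b ⟨j, c, ⟨s + 1, h⟩⟩ else 0

variable (M : Type u) [AddCommGroup M] [Module k M] [Module (MonoidAlgebra k E) M]
  [IsScalarTower k (MonoidAlgebra k E) M]

variable (k) in
/-- `M` has constant Jordan type: the Jordan type of `X_α` on `M` is the same for all `α ≠ 0`. -/
def HasConstantJordanType : Prop :=
  ∃ a : Fin p → ℕ, ∀ α : Fin r → k, α ≠ 0 → HasJordanType (Algebra.lsmul k k M (XElt e α)) a

variable (k) in
/-- The sheaf `𝓕ᵢ(M)` on `ℙ^{r-1}`. -/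
def bundleF (i : ℕ) : (PSpace k r).Modules :=
  subquotient (fun j => Algebra.lsmul k k M (genX k e j)) i

variable (k r) in
/-- The Zariski topology on the set `ℙ^{r-1}(k)` of lines in `k^r`, whose basic open sets are the
non-vanishing loci of homogeneous polynomials. -/
abbrev zariski : TopologicalSpace (ℙ k (Fin r → k)) :=
  TopologicalSpace.generateFrom
    {U | ∃ (f : MvPolynomial (Fin r) k) (d : ℕ), f.IsHomogeneous d ∧
      U = {x | MvPolynomial.eval x.rep f ≠ 0}}

/-- The submodule `∑_{ᾱ ∈ U} Ker(X_α^n, M)`, where `U` is a set of points of `ℙ^{r-1}(k)`. -/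
def kernelSum (n : ℕ) (U : Set (ℙ k (Fin r → k))) : Submodule (MonoidAlgebra k E) M :=
  ⨆ (α : Fin r → k) (hα : α ≠ 0) (_ : Projectivization.mk k α hα ∈ U),
    LinearMap.ker (LinearMap.lsmul (MonoidAlgebra k E) M (XElt e α ^ n))

variable (k) in
/-- The `n`th power generic kernel `𝔎ⁿ(M)`: the intersection of the submodules
`∑_{ᾱ ∈ U} Ker(X_α^n, M)` over all dense open subsets `U` of `ℙ^{r-1}(k)`. -/
def genericKernel (n : ℕ) : Submodule (MonoidAlgebra k E) M :=
  ⨅ (U : Set (ℙ k (Fin r → k))) (_ : @IsOpen _ (zariski k r) U) (_ : @Dense _ (zariski k r) U),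
    kernelSum e M n U

variable (k) in
/-- The `n`th power generic image `𝔍ⁿ(M) = ⋂_ᾱ Img(X_α^n, M)`. -/
def genericImage (n : ℕ) : Submodule (MonoidAlgebra k E) M :=
  ⨅ (α : Fin r → k) (_ : α ≠ 0),
    LinearMap.range (LinearMap.lsmul (MonoidAlgebra k E) M (XElt e α ^ n))

end GroupAlgebra

end GenericKernels

end

noncomputable section

namespace GenericKernels

attribute [local instance] MvPolynomial.gradedAlgebra

/-! ### Diagram chases with subobjects in an abelian category. -/

section Abelian

variable {C : Type*} [Category C] [Abelian C]

/-! Locally, a section of `Ker θ ∩ Im θ^j` is `θ^j z` with `θ^{j+1} z = 0`. Two diagram chases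
follow. A submodule whose twists contain the kernels of all `θ^j`, `j ≤ i + 1`, has the same `𝓕ᵢ`
(`nonempty_iso_of_mono`). A quotient by `W` with every twist of `W` inside `Im θ^{i+1}` has the same
`𝓕ᵢ` (`nonempty_iso_of_epi`).

The generic kernel is of the first kind. After clearing denominators, a section killed by `θ^j` is a
polynomial vector `t` with `t(α) ∈ Ker X_α^j`. Over a dense open `U` these values lie in the sum of
kernels defining `𝔎ⁿ`, and a polynomial vector with values in a subspace on a nonempty open set has
its coefficients there (`coeffVec_mem_genericKernel`).

The generic image is of the second kind if the rank of `X_α^{i+1}` is constant. Then `θ^{i+1}`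
locally has a generalized inverse with polynomial entries, up to a denominator
(`exists_generalized_inverse`), so vectors in every `Im X_α^{i+1}` lift locally through `θ^{i+1}`.

Composing the two reductions in either order gives the two isomorphisms. Taking the kernel first
requires constant rank on `𝔎ⁿ(M)`. The generalized inverse supplies it: every `Ker X_β^{i+1}` lies
in `𝔎ⁿ(M)`, so restriction to `𝔎ⁿ(M)` leaves these kernels unchanged
(`finrank_range_genericKernel`). -/

theorem factors_iff_comp_cokernel {X A : C} (P : Subobject X) (x : A ⟶ X) :
    P.Factors x ↔ x ≫ cokernel.π P.arrow = 0 := by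
  refine ⟨fun h => ?_, fun h => ?_⟩
  · rw [← P.factorThru_arrow x h, Category.assoc, cokernel.condition, comp_zero]
  · rw [← Abelian.monoLift_comp P.arrow x h]
    exact Subobject.factors_of_factors_right _ (Subobject.factors_self _)

theorem factors_of_epi_comp {X : C} (P : Subobject X) {A A' : C} (π : A' ⟶ A) [Epi π]
    {x : A ⟶ X} (h : P.Factors (π ≫ x)) : P.Factors x := by
  rw [factors_iff_comp_cokernel] at h ⊢
  rwa [← cancel_epi π, comp_zero, ← Category.assoc]

/-- The epimorphism `π` plays the role of a covering: a preimage under `f` need only exist locally.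
-/
theorem imageSubobject_factors_iff {X Y : C} (f : X ⟶ Y) {A : C} (y : A ⟶ Y) :
    (imageSubobject f).Factors y ↔
      ∃ (A' : C) (π : A' ⟶ A) (_ : Epi π) (x : A' ⟶ X), π ≫ y = x ≫ f := by
  constructor
  · intro h
    obtain ⟨A', π, hπ, x, hx⟩ := surjective_up_to_refinements_of_epi
      (factorThruImageSubobject f) ((imageSubobject f).factorThru y h)
    refine ⟨A', π, hπ, x, ?_⟩
    have := congrArg (· ≫ (imageSubobject f).arrow) hx
    simpa using this
  · rintro ⟨A', π, hπ, x, hx⟩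
    refine factors_of_epi_comp _ π ?_
    rw [hx]
    exact imageSubobject_factors_comp_self _ _

/-- Read on generalized elements, `h₁` restricts `f` to `P₁ → P₁'`, `h₂` makes the map on quotients
well defined and injective, and `h₃` makes it surjective. -/
theorem nonempty_iso_cokernel {X X' : C} (f : X ⟶ X') {P₁ P₂ : Subobject X} (h : P₂ ≤ P₁)
    {P₁' P₂' : Subobject X'} (h' : P₂' ≤ P₁')
    (h₁ : ∀ {A : C} (x : A ⟶ X), P₁.Factors x → P₁'.Factors (x ≫ f))
    (h₂ : ∀ {A : C} (x : A ⟶ X), P₁.Factors x → (P₂'.Factors (x ≫ f) ↔ P₂.Factors x))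
    (h₃ : ∀ {A : C} (x' : A ⟶ X'), P₁'.Factors x' →
      ∃ (A' : C) (π : A' ⟶ A) (_ : Epi π) (x : A' ⟶ X),
        P₁.Factors x ∧ P₂'.Factors (π ≫ x' - x ≫ f)) :
    Nonempty (cokernel (Subobject.ofLE P₂ P₁ h) ≅ cokernel (Subobject.ofLE P₂' P₁' h')) := by
  have hP {A : C} (x : A ⟶ (P₁ : C)) : P₁.Factors (x ≫ P₁.arrow) :=
    Subobject.factors_of_factors_right _ (Subobject.factors_self _)
  let g : (P₁ : C) ⟶ (P₁' : C) := P₁'.factorThru (P₁.arrow ≫ f) (h₁ _ (Subobject.factors_self _))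
  have hg : g ≫ P₁'.arrow = P₁.arrow ≫ f := Subobject.factorThru_arrow _ _ _
  have hzero {A : C} {Y : C} {Q₁ Q₂ : Subobject Y} (hQ : Q₂ ≤ Q₁) (x : A ⟶ (Q₁ : C))
      (hx : Q₂.Factors (x ≫ Q₁.arrow)) : x ≫ cokernel.π (Subobject.ofLE Q₂ Q₁ hQ) = 0 := by
    have : x = Q₂.factorThru _ hx ≫ Subobject.ofLE Q₂ Q₁ hQ := by
      rw [← cancel_mono Q₁.arrow]; simp
    rw [this, Category.assoc, cokernel.condition, comp_zero]
  have hgz : Subobject.ofLE P₂ P₁ h ≫ g ≫ cokernel.π (Subobject.ofLE P₂' P₁' h') = 0 := by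
    rw [← Category.assoc]
    apply hzero
    rw [Category.assoc, hg, ← Category.assoc, Subobject.ofLE_arrow]
    exact (h₂ _ (Subobject.factors_of_le _ h (Subobject.factors_self _))).2
      (Subobject.factors_self _)
  let φ := cokernel.desc _ _ hgz
  have hφ : cokernel.π _ ≫ φ = g ≫ cokernel.π (Subobject.ofLE P₂' P₁' h') := cokernel.π_desc _ _ _
  have : Epi (g ≫ cokernel.π (Subobject.ofLE P₂' P₁' h')) := by
    rw [epi_iff_surjective_up_to_refinements]
    intro A y
    obtain ⟨A₁, π₁, _, y₁, hy₁⟩ := surjective_up_to_refinements_of_epi (cokernel.π _) y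
    obtain ⟨A₂, π₂, _, x, hx, hx'⟩ := h₃ (y₁ ≫ P₁'.arrow)
      (Subobject.factors_of_factors_right _ (Subobject.factors_self _))
    refine ⟨A₂, π₂ ≫ π₁, inferInstance, P₁.factorThru x hx, ?_⟩
    have := hzero h' (π₂ ≫ y₁ - P₁.factorThru x hx ≫ g) (by
      rwa [Preadditive.sub_comp, Category.assoc, Category.assoc, hg, Subobject.factorThru_arrow_assoc])
    rw [Preadditive.sub_comp, sub_eq_zero] at this
    rw [Category.assoc, hy₁, ← Category.assoc, this, Category.assoc]
  have : Epi φ := epi_of_epi_fac hφ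
  have : Mono φ := by
    refine Preadditive.mono_of_cancel_zero _ fun {A} a ha => ?_
    obtain ⟨A₁, π₁, _, a₁, ha₁⟩ := surjective_up_to_refinements_of_epi (cokernel.π _) a
    have h0 : (a₁ ≫ g) ≫ cokernel.π (Subobject.ofLE P₂' P₁' h') = 0 := by
      rw [Category.assoc, ← hφ, ← Category.assoc, ← ha₁, Category.assoc, ha, comp_zero]
    obtain ⟨A₂, π₂, _, b, hb⟩ := (CokernelCofork.IsColimit.comp_π_eq_zero_iff_up_to_refinements
      (cokernelIsCokernel (Subobject.ofLE P₂' P₁' h')) _).1 h0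
    have h4 : P₂.Factors (a₁ ≫ P₁.arrow) := by
      refine (h₂ _ (hP a₁)).1 (factors_of_epi_comp _ π₂ ?_)
      have h5 : π₂ ≫ (a₁ ≫ P₁.arrow) ≫ f = b ≫ P₂'.arrow := by
        have := congrArg (· ≫ P₁'.arrow) hb
        simpa [hg] using this
      rw [h5]
      exact Subobject.factors_of_factors_right _ (Subobject.factors_self _)
    rw [← cancel_epi π₁, ha₁, comp_zero]
    exact hzero h _ h4
  have : IsIso φ := isIso_of_mono_of_epi φ
  exact ⟨asIso φ⟩

variable (C) in
/-- A sequence of objects with composable powers of an operator of degree one. -/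
structure GradedOperator where
  /-- the object in each degree -/
  obj : ℤ → C
  /-- the powers of the operator -/
  pow (j : ℕ) (n n' : ℤ) (h : n + j = n') : obj n ⟶ obj n'
  pow_comp (i j : ℕ) (n n' n'' : ℤ) (h : n + i = n') (h' : n' + j = n'') :
    pow i n n' h ≫ pow j n' n'' h' = pow (i + j) n n'' (by rw [← h', ← h]; push_cast; ring)

namespace GradedOperator

variable (T T' : GradedOperator C)

/-- `Ker θ` in degree zero. -/
def ker : Subobject (T.obj 0) := kernelSubobject (T.pow 1 0 1 rfl)

/-- `Im θ^j` in degree zero. -/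
def im (j : ℕ) : Subobject (T.obj 0) := imageSubobject (T.pow j (-j) 0 (by simp))

/-- Morphisms of graded operators. -/
structure Hom where
  /-- the components of the morphism -/
  app (n : ℤ) : T.obj n ⟶ T'.obj n
  comm (j : ℕ) (n n' : ℤ) (h : n + j = n') : app n ≫ T'.pow j n n' h = T.pow j n n' h ≫ app n'

variable {T T'}

theorem inf_factors_iff {j : ℕ} {A : C} (x : A ⟶ T.obj 0) :
    (T.ker ⊓ T.im j).Factors x ↔ x ≫ T.pow 1 0 1 rfl = 0 ∧
      ∃ (A' : C) (π : A' ⟶ A) (_ : Epi π) (z : A' ⟶ T.obj (-j)),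
        π ≫ x = z ≫ T.pow j (-j) 0 (by simp) := by
  rw [Subobject.inf_factors, ker, im, kernelSubobject_factors_iff, imageSubobject_factors_iff]

theorem Hom.inf_factors (f : Hom T T') {j : ℕ} {A : C} (x : A ⟶ T.obj 0)
    (h : (T.ker ⊓ T.im j).Factors x) : (T'.ker ⊓ T'.im j).Factors (x ≫ f.app 0) := by
  rw [inf_factors_iff] at h ⊢
  obtain ⟨h, A', π, hπ, z, hz⟩ := h
  refine ⟨?_, A', π, hπ, z ≫ f.app _, ?_⟩
  · rw [Category.assoc, f.comm, reassoc_of% h, zero_comp]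
  · rw [reassoc_of% hz, Category.assoc, f.comm]

theorem Hom.inf_factors_of_comp (f : Hom T T') [Mono (f.app 1)] {j : ℕ} {A A' : C}
    {x : A ⟶ T.obj 0} (hx : (x ≫ f.app 0) ≫ T'.pow 1 0 1 rfl = 0) (π : A' ⟶ A) [Epi π]
    (z : A' ⟶ T.obj (-j)) (hz : π ≫ x = z ≫ T.pow j (-j) 0 (by simp)) :
    (T.ker ⊓ T.im j).Factors x := by
  refine (inf_factors_iff x).2 ⟨?_, A', π, inferInstance, z, hz⟩
  rwa [← cancel_mono (f.app 1), zero_comp, Category.assoc, ← f.comm, ← Category.assoc]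

/-- A monomorphism through which the kernels of the powers of `θ` factor induces an isomorphism
on subquotients. -/
theorem nonempty_iso_of_mono (f : Hom T T') [∀ n, Mono (f.app n)] (i : ℕ)
    (h : T.ker ⊓ T.im (i + 1) ≤ T.ker ⊓ T.im i) (h' : T'.ker ⊓ T'.im (i + 1) ≤ T'.ker ⊓ T'.im i)
    (hker : ∀ (j : ℕ) (n n' : ℤ) (hn : n + j = n') {A : C} (z : A ⟶ T'.obj n), j ≤ i + 2 →
      z ≫ T'.pow j n n' hn = 0 → ∃ w : A ⟶ T.obj n, w ≫ f.app n = z) :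
    Nonempty (cokernel (Subobject.ofLE _ _ h) ≅ cokernel (Subobject.ofLE _ _ h')) := by
  -- If `x' = θ^j z` and `θ x' = 0`, then `θ^{j+1} z = 0`, so `z` already comes from `T`. The cases
  -- `j = i` and `j = i + 1` account for the bound `i + 2` in `hker`.
  have key (j : ℕ) (hj : j ≤ i + 1) {A : C} (x' : A ⟶ T'.obj 0)
      (hx' : (T'.ker ⊓ T'.im j).Factors x') :
      ∃ (A' : C) (π : A' ⟶ A) (_ : Epi π) (z : A' ⟶ T.obj (-j)),
        π ≫ x' = (z ≫ T.pow j (-j) 0 (by simp)) ≫ f.app 0 := by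
    rw [inf_factors_iff] at hx'
    obtain ⟨hx, A', π, hπ, z, hz⟩ := hx'
    obtain ⟨w, rfl⟩ := hker (j + 1) (-j) 1 (by push_cast; ring) z (by omega) (by
      rw [← T'.pow_comp j 1 (-j) 0 1 (by simp) rfl, ← Category.assoc, ← hz, Category.assoc, hx,
        comp_zero])
    exact ⟨A', π, hπ, w, by rw [hz, Category.assoc, Category.assoc, f.comm]⟩
  refine nonempty_iso_cokernel (f.app 0) h h' (fun x hx => f.inf_factors x hx)
    (fun x _ => ⟨fun hx' => ?_, f.inf_factors x⟩) (fun x' hx' => ?_)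
  · obtain ⟨A', π, hπ, z, hz⟩ := key (i + 1) le_rfl _ hx'
    refine f.inf_factors_of_comp ((inf_factors_iff _).1 hx').1 π z ?_
    rwa [← cancel_mono (f.app 0), Category.assoc]
  · obtain ⟨A', π, hπ, z, hz⟩ := key i (by omega) _ hx'
    refine ⟨A', π, hπ, z ≫ T.pow i (-i) 0 (by simp), ?_, ?_⟩
    · refine f.inf_factors_of_comp ?_ (𝟙 _) z (Category.id_comp _)
      rw [← hz, Category.assoc, ((inf_factors_iff _).1 hx').1, comp_zero]
    · rw [hz, sub_self]
      exact Subobject.factors_zero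

/-- An epimorphism whose kernel is contained in the image of `θ^{i+2}` induces an isomorphism
on subquotients. -/
theorem nonempty_iso_of_epi (f : Hom T T') [∀ n, Epi (f.app n)] (i : ℕ)
    (h : T.ker ⊓ T.im (i + 1) ≤ T.ker ⊓ T.im i) (h' : T'.ker ⊓ T'.im (i + 1) ≤ T'.ker ⊓ T'.im i)
    (him : ∀ (n n' : ℤ) (hn : n + (i + 2 : ℕ) = n') {A : C} (x : A ⟶ T.obj n'),
      x ≫ f.app n' = 0 → ∃ (A' : C) (π : A' ⟶ A) (_ : Epi π) (w : A' ⟶ T.obj n),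
        π ≫ x = w ≫ T.pow (i + 2) n n' hn) :
    Nonempty (cokernel (Subobject.ofLE _ _ h) ≅ cokernel (Subobject.ofLE _ _ h')) := by
  refine nonempty_iso_cokernel (f.app 0) h h' (fun x hx => f.inf_factors x hx)
    (fun x hx => ⟨fun hx' => ?_, f.inf_factors x⟩) (fun x' hx' => ?_)
  · rw [inf_factors_iff] at hx hx' ⊢
    refine ⟨hx.1, ?_⟩
    obtain ⟨-, A₁, π₁, _, z, hz⟩ := hx'
    obtain ⟨A₂, π₂, _, w, hw⟩ := surjective_up_to_refinements_of_epi (f.app _) z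
    -- Injectivity: `w` lifts `z`, so `x - θ^{i+1} w` dies under `f` and equals `θ^{i+2} u`; hence
    -- `x = θ^{i+1} (w + θ u)`.
    obtain ⟨A₃, π₃, _, u, hu⟩ := him (-(i + 2 : ℕ)) 0 (by simp)
      (π₂ ≫ π₁ ≫ x - w ≫ T.pow (i + 1) (-(i + 1 : ℕ)) 0 (by simp)) (by
        rw [Preadditive.sub_comp, Category.assoc, Category.assoc, Category.assoc, hz, ← f.comm,
          reassoc_of% hw, sub_self])
    refine ⟨A₃, π₃ ≫ π₂ ≫ π₁, inferInstance,
      π₃ ≫ w + u ≫ T.pow 1 (-(i + 2 : ℕ)) (-(i + 1 : ℕ)) (by push_cast; ring), ?_⟩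
    rw [Preadditive.comp_sub, sub_eq_iff_eq_add] at hu
    rw [Preadditive.add_comp, Category.assoc u, T.pow_comp, Category.assoc, Category.assoc,
      Category.assoc, hu, add_comm]
    congr 3
    omega
  · obtain ⟨hx, A₁, π₁, _, z, hz⟩ := (inf_factors_iff _).1 hx'
    obtain ⟨A₂, π₂, _, w, hw⟩ := surjective_up_to_refinements_of_epi (f.app _) z
    have hw' : (w ≫ T.pow i (-i) 0 (by simp)) ≫ f.app 0 = π₂ ≫ π₁ ≫ x' := by
      rw [Category.assoc, ← f.comm, ← reassoc_of% hw, hz]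
    obtain ⟨A₃, π₃, _, u, hu⟩ := him (-(i + 1 : ℕ)) 1 (by push_cast; ring)
      (w ≫ T.pow (i + 1) (-i) 1 (by push_cast; ring)) (by
        rw [Category.assoc, ← f.comm, ← T'.pow_comp i 1 (-i) 0 1 (by simp) rfl, ← Category.assoc w,
          ← hw, Category.assoc, reassoc_of% hz.symm, hx, comp_zero, comp_zero])
    -- Surjectivity: `w` lifts `z`, but `θ^{i+1} w = θ^{i+2} u` may be nonzero. The correction by `θ
    -- u` gives `θ^{i+1} y = 0` and changes `θ^i w` only by `θ^{i+1} u`, which is zero in the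
    -- quotient.
    let y := π₃ ≫ w - u ≫ T.pow 1 (-(i + 1 : ℕ)) (-i) (by push_cast; ring)
    have hy : (y ≫ T.pow i (-i) 0 (by simp)) ≫ T.pow 1 0 1 rfl = 0 := by
      have : T.pow (i + 2) (-(i + 1 : ℕ)) 1 (by push_cast; ring) =
          T.pow (1 + (i + 1)) (-(i + 1 : ℕ)) 1 (by push_cast; ring) := by
        congr 1
        omega
      rw [Category.assoc, T.pow_comp, Preadditive.sub_comp, Category.assoc, hu, Category.assoc,
        T.pow_comp, this, sub_self]
    have hyz : (T.ker ⊓ T.im i).Factors (y ≫ T.pow i (-i) 0 (by simp)) :=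
      (inf_factors_iff _).2 ⟨hy, _, 𝟙 _, inferInstance, y, Category.id_comp _⟩
    have hd : (π₃ ≫ π₂ ≫ π₁) ≫ x' - (y ≫ T.pow i (-i) 0 (by simp)) ≫ f.app 0 =
        (u ≫ f.app _) ≫ T'.pow (i + 1) (-(i + 1 : ℕ)) 0 (by simp) := by
      rw [Preadditive.sub_comp, Preadditive.sub_comp, Category.assoc, Category.assoc π₂, ← hw',
        Category.assoc π₃, Category.assoc π₃, Category.assoc u, T.pow_comp, sub_sub_cancel,
        Category.assoc, Category.assoc, f.comm]
      congr 3
      omega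
    refine ⟨A₃, π₃ ≫ π₂ ≫ π₁, inferInstance, _, hyz, (inf_factors_iff _).2
      ⟨?_, _, 𝟙 _, inferInstance, u ≫ f.app _, by rw [Category.id_comp, hd]⟩⟩
    rw [Preadditive.sub_comp, Category.assoc, hx, comp_zero,
      ((inf_factors_iff _).1 (f.inf_factors _ hyz)).1, sub_zero]

end GradedOperator

end Abelian

/-! ### Functoriality of the twists `M ⊗ 𝒪(n)` in `M`. -/

section TwistMap

variable {k : Type u} [Field k] {r : ℕ}
variable {M M' M'' : Type u} [AddCommGroup M] [Module k M] [AddCommGroup M'] [Module k M']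
  [AddCommGroup M''] [Module k M'']

theorem toFib_baseChange (f : M →ₗ[k] M') (x : ProjectiveSpectrum (grading k r))
    (t : S k r ⊗[k] M) :
    toFib M' x (f.baseChange (S k r) t) = f.baseChange (Loc x) (toFib M x t) := by
  induction t with
  | zero => simp
  | add t t' h h' => rw [map_add, map_add, map_add, map_add, h, h']
  | tmul f m => simp [toFib]

theorem baseChange_mem_homPart (f : M →ₗ[k] M') {a : ℕ} {t : S k r ⊗[k] M}
    (ht : t ∈ homPart M a) : f.baseChange (S k r) t ∈ homPart M' a := by
  obtain ⟨t, rfl⟩ := ht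
  refine ⟨LinearMap.lTensor _ f t, ?_⟩
  induction t with
  | zero => simp
  | add x y hx hy => rw [map_add, map_add, map_add, map_add, hx, hy]
  | tmul f m => simp

theorem baseChange_pred (f : M →ₗ[k] M') {n : ℤ} {U : Opens (PTop k r)} {s : ∀ x : U, Fib M x.1}
    (hs : (locallyFraction M n).pred s) :
    (locallyFraction M' n).pred (fun x => f.baseChange (Loc x.1) (s x)) := by
  intro x
  obtain ⟨V, hV, i, a, b, t, g, hab, ht, hg, h⟩ := hs x
  refine ⟨V, hV, i, a, b, f.baseChange (S k r) t, g, hab, baseChange_mem_homPart f ht, hg,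
    fun y => ⟨(h y).1, ?_⟩⟩
  refine Eq.trans ?_ (toFib_baseChange f y.1 t).symm
  refine Eq.trans ?_ (congrArg (f.baseChange (Loc y.1)) (h y).2)
  exact ((f.baseChange (Loc y.1)).map_smul_of_tower g (s (i y))).symm

/-- The morphism `M ⊗ 𝒪(n) → M' ⊗ 𝒪(n)` induced by a linear map `M → M'`. -/
def twistMap (f : M →ₗ[k] M') (n : ℤ) : (twist M n : (PSpace k r).Modules) ⟶ twist M' n where
  val :=
    { app := fun U => ModuleCat.ofHom (X := (twistPresheaf M n).obj U)
        (Y := (twistPresheaf M' n).obj U)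
        { toFun := fun s => (⟨fun x => f.baseChange (Loc x.1) (s.1 x),
            baseChange_pred f s.2⟩ : (twistInType M' n).1.obj U)
          map_add' := fun _ _ => Subtype.ext <| funext fun _ => map_add _ _ _
          map_smul' := fun _ _ => Subtype.ext <| funext fun x =>
            (f.baseChange (Loc x.1)).map_smul _ _ }
      naturality := fun _ => rfl }

theorem twistMap_id (n : ℤ) :
    twistMap (r := r) (LinearMap.id : M →ₗ[k] M) n = 𝟙 (twist M n) := by
  refine AlgebraicGeometry.Scheme.Modules.hom_ext _ _ fun U => ?_
  refine ConcreteCategory.hom_ext _ _ fun s => Subtype.ext <| funext fun x => ?_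
  exact LinearMap.congr_fun (LinearMap.baseChange_id) _

theorem twistMap_comp (f : M →ₗ[k] M') (g : M' →ₗ[k] M'') (n : ℤ) :
    twistMap (r := r) f n ≫ twistMap g n = twistMap (g ∘ₗ f) n := by
  refine AlgebraicGeometry.Scheme.Modules.hom_ext _ _ fun U => ?_
  refine ConcreteCategory.hom_ext _ _ fun s => Subtype.ext <| funext fun x => ?_
  exact (LinearMap.congr_fun (LinearMap.baseChange_comp f g) _).symm

theorem twistMap_add (f g : M →ₗ[k] M') (n : ℤ) :
    twistMap (r := r) (f + g) n = twistMap f n + twistMap g n := by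
  refine AlgebraicGeometry.Scheme.Modules.hom_ext _ _ fun U => ?_
  refine ConcreteCategory.hom_ext _ _ fun s => Subtype.ext <| funext fun x => ?_
  exact (LinearMap.congr_fun (LinearMap.baseChange_add f g) _)

theorem fibTheta_baseChange {A : Fin r → Module.End k M} {A' : Fin r → Module.End k M'}
    {f : M →ₗ[k] M'} (hf : ∀ j, f ∘ₗ A j = A' j ∘ₗ f) (x : ProjectiveSpectrum (grading k r))
    (j : ℕ) (z : Fib M x) :
    (fibTheta A' x ^ j) (f.baseChange _ z) = f.baseChange _ ((fibTheta A x ^ j) z) := by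
  have h1 (z : Fib M x) : fibTheta A' x (f.baseChange _ z) = f.baseChange _ (fibTheta A x z) := by
    simp only [fibTheta, LinearMap.sum_apply, LinearMap.smul_apply, map_sum, map_smul]
    refine Finset.sum_congr rfl fun j _ => ?_
    rw [← LinearMap.comp_apply, ← LinearMap.comp_apply, ← LinearMap.baseChange_comp,
      ← LinearMap.baseChange_comp, hf]
  induction j generalizing z with
  | zero => rfl
  | succ j ih => rw [pow_succ, pow_succ, Module.End.mul_apply, Module.End.mul_apply, h1, ih]

theorem twistMap_thetaPow {A : Fin r → Module.End k M} {A' : Fin r → Module.End k M'}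
    {f : M →ₗ[k] M'} (hf : ∀ j, f ∘ₗ A j = A' j ∘ₗ f) (j : ℕ) (n n' : ℤ) (h : n + j = n') :
    twistMap f n ≫ thetaPow A' j n n' h = thetaPow A j n n' h ≫ twistMap f n' := by
  refine AlgebraicGeometry.Scheme.Modules.hom_ext _ _ fun U => ?_
  refine ConcreteCategory.hom_ext _ _ fun s => Subtype.ext <| funext fun x => ?_
  exact fibTheta_baseChange hf x.1 j (s.1 x)

/-- The twists of `M` with the powers of `θ`. -/
def thetaOperator (A : Fin r → Module.End k M) : GradedOperator (PSpace k r).Modules where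
  obj := twist M
  pow := thetaPow A
  pow_comp := thetaPow_comp A

/-- The morphism induced by an intertwining map. -/
def thetaHom {A : Fin r → Module.End k M} {A' : Fin r → Module.End k M'}
    (f : M →ₗ[k] M') (hf : ∀ j, f ∘ₗ A j = A' j ∘ₗ f) :
    GradedOperator.Hom (thetaOperator A) (thetaOperator A') where
  app := twistMap f
  comm := twistMap_thetaPow hf

/-- Injections of vector spaces split, and functors preserve retractions; no stalks are needed. -/
theorem mono_twistMap {f : M →ₗ[k] M'} (hf : Function.Injective f) (n : ℤ) :
    Mono (twistMap (r := r) f n) := by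
  obtain ⟨g, hg⟩ := f.exists_leftInverse_of_injective (LinearMap.ker_eq_bot.2 hf)
  have : Mono (twistMap (r := r) f n ≫ twistMap g n) := by
    rw [twistMap_comp, hg, twistMap_id]
    infer_instance
  exact mono_of_mono _ (twistMap g n)

theorem epi_twistMap {f : M →ₗ[k] M'} (hf : Function.Surjective f) (n : ℤ) :
    Epi (twistMap (r := r) f n) := by
  obtain ⟨g, hg⟩ := f.exists_rightInverse_of_surjective (LinearMap.range_eq_top.2 hf)
  have : Epi (twistMap (r := r) g n ≫ twistMap f n) := by
    rw [twistMap_comp, hg, twistMap_id]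
    infer_instance
  exact epi_of_epi (twistMap g n) _

/-- Exactness of the functor `M ↦ M ⊗ 𝒪(n)`. -/
theorem exists_comp_twistMap_eq {f : M →ₗ[k] M'} {g : M' →ₗ[k] M''}
    (hf : Function.Injective f) (hg : Function.Surjective g) (hfg : Function.Exact f g)
    (n : ℤ) {A : (PSpace k r).Modules} (z : A ⟶ twist M' n) (hz : z ≫ twistMap g n = 0) :
    ∃ w : A ⟶ twist M n, w ≫ twistMap f n = z := by
  obtain ⟨f', hf'⟩ := f.exists_leftInverse_of_injective (LinearMap.ker_eq_bot.2 hf)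
  have hker : LinearMap.ker g ≤ LinearMap.ker (LinearMap.id - f ∘ₗ f') := by
    intro m hm
    obtain ⟨m, rfl⟩ := (hfg m).1 hm
    have h1 : f' (f m) = m := LinearMap.congr_fun hf' m
    simp [h1]
  obtain ⟨g', hg'⟩ := g.exists_rightInverse_of_surjective (LinearMap.range_eq_top.2 hg)
  -- Since `id - f f'` vanishes on `ker g`, it factors through `g`. The additive functor carries
  -- this identity to the twists, where `z` kills the second summand.
  have hid : f ∘ₗ f' + ((LinearMap.id - f ∘ₗ f') ∘ₗ g') ∘ₗ g = LinearMap.id := by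
    ext m
    have h1 : g' (g m) - m ∈ LinearMap.ker g := by
      have h1 : g (g' (g m)) = g m := LinearMap.congr_fun hg' (g m)
      simp [h1]
    have := hker h1
    rw [LinearMap.mem_ker, map_sub, sub_eq_zero] at this
    rw [LinearMap.add_apply, LinearMap.comp_apply, LinearMap.comp_apply, LinearMap.comp_apply, this]
    simp
  refine ⟨z ≫ twistMap f' n, ?_⟩
  have := congrArg (fun h => z ≫ twistMap (r := r) h n) hid
  simp only [twistMap_add, ← twistMap_comp, twistMap_id, Preadditive.comp_add, reassoc_of% hz,
    zero_comp, add_zero, Category.comp_id] at this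
  simpa using this

end TwistMap

/-! ### Elements of `S ⊗ M` as polynomials with coefficients in `M`. -/

section PolynomialVectors

variable {k : Type u} [Field k] {r : ℕ}
variable {M M' : Type u} [AddCommGroup M] [Module k M] [AddCommGroup M'] [Module k M']

/-- The polynomial obtained by applying a linear functional to the coefficients of a polynomial
vector. -/
def contract (φ : M →ₗ[k] k) : S k r ⊗[k] M →ₗ[k] S k r :=
  (TensorProduct.rid k (S k r)).toLinearMap ∘ₗ LinearMap.lTensor (S k r) φ

/-- The coefficients of a polynomial vector. -/
def coeffVec (d : Fin r →₀ ℕ) : S k r ⊗[k] M →ₗ[k] M :=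
  (TensorProduct.lid k M).toLinearMap ∘ₗ LinearMap.rTensor M (MvPolynomial.lcoeff k d)

/-- The value of a polynomial vector at a point. -/
def evalVec (α : Fin r → k) : S k r ⊗[k] M →ₗ[k] M :=
  (TensorProduct.lid k M).toLinearMap ∘ₗ
    LinearMap.rTensor M (MvPolynomial.aeval (R := k) α).toLinearMap

@[simp] theorem contract_tmul (φ : M →ₗ[k] k) (f : S k r) (m : M) :
    contract φ (f ⊗ₜ m) = φ m • f := by simp [contract]

@[simp] theorem coeffVec_tmul (d : Fin r →₀ ℕ) (f : S k r) (m : M) :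
    coeffVec d (f ⊗ₜ m) = f.coeff d • m := by simp [coeffVec]

@[simp] theorem evalVec_tmul (α : Fin r → k) (f : S k r) (m : M) :
    evalVec α (f ⊗ₜ m) = MvPolynomial.eval α f • m := by
  simp [evalVec, MvPolynomial.aeval_eq_eval]

theorem coeff_contract (φ : M →ₗ[k] k) (d : Fin r →₀ ℕ) (t : S k r ⊗[k] M) :
    (contract φ t).coeff d = φ (coeffVec d t) := by
  induction t with
  | zero => simp
  | add t t' h h' => simp [h, h']
  | tmul f m => simp [mul_comm]

theorem eval_contract (φ : M →ₗ[k] k) (α : Fin r → k) (t : S k r ⊗[k] M) :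
    MvPolynomial.eval α (contract φ t) = φ (evalVec α t) := by
  induction t with
  | zero => simp
  | add t t' h h' => simp [h, h']
  | tmul f m => simp [mul_comm, MvPolynomial.smul_eval]

theorem evalVec_smul (α : Fin r → k) (f : S k r) (t : S k r ⊗[k] M) :
    evalVec α (f • t) = MvPolynomial.eval α f • evalVec α t := by
  induction t with
  | zero => simp
  | add t t' h h' => simp [h, h']
  | tmul g m => simp [TensorProduct.smul_tmul', mul_smul]

theorem coeffVec_baseChange (f : M →ₗ[k] M') (d : Fin r →₀ ℕ) (t : S k r ⊗[k] M) :
    coeffVec d (f.baseChange (S k r) t) = f (coeffVec d t) := by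
  induction t with
  | zero => simp
  | add t t' h h' => simp [h, h']
  | tmul g m => simp

theorem eq_zero_of_contract {t : S k r ⊗[k] M} (h : ∀ φ : M →ₗ[k] k, contract φ t = 0) :
    t = 0 := by
  let b := Module.Basis.ofVectorSpace k M
  have key (t : S k r ⊗[k] M) (i) : (b.baseChange (S k r)).repr t i = contract (b.coord i) t := by
    induction t with
    | zero => simp
    | add t t' ht ht' => simp [ht, ht']
    | tmul g m => simp
  exact (b.baseChange (S k r)).ext_elem fun i => by rw [key, h, map_zero, Finsupp.zero_apply]

theorem eq_zero_of_coeffVec {t : S k r ⊗[k] M} (h : ∀ d, coeffVec d t = 0) : t = 0 :=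
  eq_zero_of_contract fun φ => MvPolynomial.ext _ _ fun d => by
    rw [coeff_contract, h, map_zero, MvPolynomial.coeff_zero]

/-- A vector outside `W` is detected by a functional that vanishes on `W`, which reduces membership
to scalar polynomials. -/
theorem coeffVec_mem_of_contract {W : Submodule k M} {t : S k r ⊗[k] M}
    (h : ∀ φ : M →ₗ[k] k, W ≤ LinearMap.ker φ → contract φ t = 0) (d : Fin r →₀ ℕ) :
    coeffVec d t ∈ W := by
  by_contra hd
  obtain ⟨φ, hφ, hW⟩ := Submodule.exists_le_ker_of_notMem hd
  exact hφ (by rw [← coeff_contract, h φ hW, MvPolynomial.coeff_zero])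

theorem evalVec_mem_of_coeffVec {W : Submodule k M} {t : S k r ⊗[k] M}
    (h : ∀ d, coeffVec d t ∈ W) (α : Fin r → k) : evalVec α t ∈ W := by
  by_contra hd
  obtain ⟨φ, hφ, hW⟩ := Submodule.exists_le_ker_of_notMem hd
  refine hφ ?_
  have : contract φ t = 0 := MvPolynomial.ext _ _ fun d => by
    rw [coeff_contract, MvPolynomial.coeff_zero]
    exact hW (h d)
  rw [← eval_contract, this, map_zero]

/-- The operator `∑ⱼ αⱼ Aⱼ`. -/
def opAt (A : Fin r → Module.End k M) (α : Fin r → k) : Module.End k M := ∑ j, α j • A j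

theorem evalVec_polyTheta (A : Fin r → Module.End k M) (α : Fin r → k) (j : ℕ)
    (t : S k r ⊗[k] M) :
    evalVec α ((polyTheta A ^ j) t) = (opAt A α ^ j) (evalVec α t) := by
  have h1 (t : S k r ⊗[k] M) : evalVec α (polyTheta A t) = opAt A α (evalVec α t) := by
    induction t with
    | zero => simp
    | add t t' h h' => simp [h, h']
    | tmul g m =>
      simp only [polyTheta, opAt, LinearMap.sum_apply, LinearMap.smul_apply,
        LinearMap.baseChange_tmul, TensorProduct.smul_tmul', smul_eq_mul, map_sum, evalVec_tmul,
        map_mul, MvPolynomial.eval_X, map_smul, mul_smul, Finset.smul_sum]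
      exact Finset.sum_congr rfl fun j _ => smul_comm _ _ _
  induction j generalizing t with
  | zero => rfl
  | succ j ih => rw [pow_succ, pow_succ, Module.End.mul_apply, Module.End.mul_apply, ih, h1]

theorem toFib_polyTheta_pow (A : Fin r → Module.End k M) (x : ProjectiveSpectrum (grading k r))
    (j : ℕ) (t : S k r ⊗[k] M) :
    toFib M x ((polyTheta A ^ j) t) = (fibTheta A x ^ j) (toFib M x t) := by
  induction j generalizing t with
  | zero => rfl
  | succ j ih =>
    rw [pow_succ, pow_succ, Module.End.mul_apply, Module.End.mul_apply, ih, toFib_polyTheta]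

theorem toFib_injective (x : ProjectiveSpectrum (grading k r)) :
    Function.Injective (toFib M x) := by
  have : Function.Injective (algebraMap (S k r) (Loc x)) :=
    IsLocalization.injective _ (x.asHomogeneousIdeal.toIdeal.primeCompl_le_nonZeroDivisors)
  exact Module.Flat.rTensor_preserves_injective_linearMap (M := M)
    ((Algebra.linearMap (S k r) (Loc x)).restrictScalars k) this

/-- Clearing denominators. Homogeneity of `D` is not asked for: the result serves to test vanishing
in a single fibre. -/
theorem exists_smul_eq_toFib (x : ProjectiveSpectrum (grading k r)) (z : Fib M x) :
    ∃ (D : S k r) (t : S k r ⊗[k] M), D ∉ x.asHomogeneousIdeal ∧ D • z = toFib M x t := by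
  induction z using TensorProduct.induction_on with
  | zero => exact ⟨1, 0, x.isPrime.one_notMem, by simp⟩
  | add z z' h h' =>
    obtain ⟨D, t, hD, h⟩ := h
    obtain ⟨D', t', hD', h'⟩ := h'
    refine ⟨D * D', D' • t + D • t', x.asHomogeneousIdeal.toIdeal.primeCompl.mul_mem hD hD', ?_⟩
    rw [map_add, map_smul, map_smul, ← h, ← h', smul_add, mul_comm, mul_smul, mul_comm, mul_smul]
  | tmul c m =>
    obtain ⟨⟨f, D⟩, hf⟩ := IsLocalization.surj x.asHomogeneousIdeal.toIdeal.primeCompl c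
    refine ⟨D, f ⊗ₜ m, D.2, ?_⟩
    simp [toFib, TensorProduct.smul_tmul', ← hf, Algebra.smul_def, mul_comm]

theorem eq_zero_of_smul_eq_zero {x : ProjectiveSpectrum (grading k r)} {D : S k r}
    (hD : D ∉ x.asHomogeneousIdeal) {z : Fib M x} (h : D • z = 0) : z = 0 := by
  have hu : IsUnit (algebraMap (S k r) (Loc x) D) :=
    IsLocalization.map_units _ (⟨D, hD⟩ : x.asHomogeneousIdeal.toIdeal.primeCompl)
  rwa [← algebraMap_smul (Loc x), hu.smul_eq_zero] at h

end PolynomialVectors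

/-! ### Points of projective space and Zariski density. -/

section Nullstellensatz

variable {k : Type u} [Field k] {r : ℕ}

theorem exists_X_notMem (x : ProjectiveSpectrum (grading k r)) :
    ∃ j, (MvPolynomial.X j : S k r) ∉ x.asHomogeneousIdeal := by
  by_contra! h
  obtain ⟨m, f, hf, hm, hfx⟩ := exists_homogeneous_notMem x
  refine hfx ?_
  have hle : Ideal.span (MvPolynomial.X '' Set.univ) ≤ x.asHomogeneousIdeal.toIdeal := by
    rw [Ideal.span_le]
    rintro _ ⟨j, -, rfl⟩
    exact h j
  refine hle (MvPolynomial.mem_ideal_span_X_image.2 fun d hd => ?_)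
  by_contra! h0
  have h1 : d = 0 := Finsupp.ext fun j => h0 j trivial
  have h2 := hf (MvPolynomial.mem_support_iff.1 hd)
  rw [h1] at h2
  simp at h2
  omega

/-- By the Nullstellensatz the prime of `x`, which omits some `X_j`, has a zero `α` with `α_j ≠ 0`.
A denominator that is nonzero at `α` is then invertible at `x`. -/
theorem exists_point [IsAlgClosed k] (x : ProjectiveSpectrum (grading k r)) :
    ∃ α : Fin r → k, α ≠ 0 ∧
      ∀ f : S k r, MvPolynomial.eval α f ≠ 0 → f ∉ x.asHomogeneousIdeal := by
  obtain ⟨j, hj⟩ := exists_X_notMem x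
  have h : MvPolynomial.X j ∉ MvPolynomial.vanishingIdeal k
      (MvPolynomial.zeroLocus k x.asHomogeneousIdeal.toIdeal) := by
    rwa [MvPolynomial.vanishingIdeal_zeroLocus_eq_radical, x.isPrime.radical]
  rw [MvPolynomial.mem_vanishingIdeal_iff] at h
  push Not at h
  obtain ⟨α, hα, h⟩ := h
  refine ⟨α, fun h0 => h (by simp [h0]), fun f hf hfx => hf ?_⟩
  simpa [MvPolynomial.aeval_eq_eval] using hα f hfx

theorem eq_zero_of_eval [Infinite k] {f h : S k r} (hh : h ≠ 0) (j : Fin r)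
    (hf : ∀ α : Fin r → k, α ≠ 0 → MvPolynomial.eval α h ≠ 0 → MvPolynomial.eval α f = 0) :
    f = 0 := by
  -- The factor `X_j` takes care of the origin and `h` of its own zero locus, so the product
  -- vanishes at every point.
  have : MvPolynomial.X j * h * f = 0 := by
    refine MvPolynomial.funext fun α => ?_
    by_cases hα : α = 0
    · simp [hα]
    by_cases hh : MvPolynomial.eval α h = 0
    · simp [hh]
    · simp [hf α hα hh]
  simpa [hh] using this

theorem eq_zero_of_evalVec [Infinite k] {M : Type u} [AddCommGroup M] [Module k M]
    {t : S k r ⊗[k] M} {h : S k r} (hh : h ≠ 0) (j : Fin r)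
    (ht : ∀ α : Fin r → k, α ≠ 0 → MvPolynomial.eval α h ≠ 0 → evalVec α t = 0) : t = 0 :=
  eq_zero_of_contract fun φ => eq_zero_of_eval hh j fun α hα hα' => by
    rw [eval_contract, ht α hα hα', map_zero]

open scoped LinearAlgebra.Projectivization

/-- The generating sets are a priori only a subbase; products of forms show that they are a base. -/
theorem exists_homogeneous_of_isOpen {U : Set (ℙ k (Fin r → k))} (hU : @IsOpen _ (zariski k r) U)
    (x : ℙ k (Fin r → k)) (hx : x ∈ U) :
    ∃ (h : S k r) (d : ℕ), h.IsHomogeneous d ∧ MvPolynomial.eval x.rep h ≠ 0 ∧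
      ∀ y : ℙ k (Fin r → k), MvPolynomial.eval y.rep h ≠ 0 → y ∈ U := by
  induction hU with
  | basic U hU =>
    obtain ⟨f, d, hf, rfl⟩ := hU
    exact ⟨f, d, hf, hx, fun y hy => hy⟩
  | univ => exact ⟨1, 0, MvPolynomial.isHomogeneous_one _ _, by simp, fun _ _ => trivial⟩
  | inter U V _ _ hU hV =>
    obtain ⟨f, d, hf, hfx, hf'⟩ := hU hx.1
    obtain ⟨g, e, hg, hgx, hg'⟩ := hV hx.2
    refine ⟨f * g, d + e, hf.mul hg, by simp [hfx, hgx], fun y hy => ?_⟩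
    rw [map_mul] at hy
    exact ⟨hf' y (left_ne_zero_of_mul hy), hg' y (right_ne_zero_of_mul hy)⟩
  | sUnion 𝒰 _ h =>
    obtain ⟨U, hU, hxU⟩ := hx
    obtain ⟨f, d, hf, hfx, hf'⟩ := h U hU hxU
    exact ⟨f, d, hf, hfx, fun y hy => ⟨U, hU, hf' y hy⟩⟩

theorem eval_rep_ne_zero {h : S k r} {d : ℕ} (hh : h.IsHomogeneous d) {α : Fin r → k} (hα : α ≠ 0)
    (h0 : MvPolynomial.eval α h ≠ 0) :
    MvPolynomial.eval (Projectivization.mk k α hα).rep h ≠ 0 := by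
  obtain ⟨c, hc⟩ := Projectivization.exists_smul_eq_mk_rep k α hα
  rw [← hc]
  have : MvPolynomial.eval (c • α) h = (c : k) ^ d * MvPolynomial.eval α h := by
    rw [MvPolynomial.eval_eq', MvPolynomial.eval_eq', Finset.mul_sum]
    refine Finset.sum_congr rfl fun m hm => ?_
    have hd := hh (MvPolynomial.mem_support_iff.1 hm)
    rw [Finsupp.weight_apply, Finsupp.sum_fintype _ _ (by simp)] at hd
    simp only [Pi.one_apply, smul_eq_mul, mul_one] at hd
    simp only [Pi.smul_apply, Units.smul_def, smul_eq_mul, mul_pow, Finset.prod_mul_distrib,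
      Finset.prod_pow_eq_pow_sum, hd]
    ring
  exact this ▸ mul_ne_zero (pow_ne_zero _ c.ne_zero) h0

/-- A polynomial vector whose values at the points of a nonempty open set lie in `W` has
coefficients in `W`. -/
theorem coeffVec_mem_of_isOpen [Infinite k] {M : Type u} [AddCommGroup M] [Module k M]
    {U : Set (ℙ k (Fin r → k))} (hU : @IsOpen _ (zariski k r) U) (hne : U.Nonempty)
    {W : Submodule k M} {t : S k r ⊗[k] M}
    (h : ∀ (α : Fin r → k) (hα : α ≠ 0), Projectivization.mk k α hα ∈ U → evalVec α t ∈ W)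
    (d : Fin r →₀ ℕ) : coeffVec d t ∈ W := by
  obtain ⟨x, hx⟩ := hne
  obtain ⟨g, e, hg, hgx, hgU⟩ := exists_homogeneous_of_isOpen hU x hx
  obtain ⟨j, -⟩ := Function.ne_iff.1 x.rep_nonzero
  refine coeffVec_mem_of_contract (fun φ hφ => ?_) d
  refine eq_zero_of_eval (h := g) (by rintro rfl; simp at hgx) j fun α hα hα' => ?_
  rw [eval_contract]
  exact hφ (h α hα (hgU _ (eval_rep_ne_zero hg hα hα')))

end Nullstellensatz

/-! ### Constant rank: generalized inverses and local lifting. -/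

section ConstantRank

variable {k : Type u} [Field k] {r : ℕ}
variable {M M' : Type u} [AddCommGroup M] [Module k M] [AddCommGroup M'] [Module k M']

/-- Invertibility of `π X ι` makes `X ι` injective, so its range has dimension `ρ` and fills `Im X`.
Writing `X u = X ι c`, the adjugate recovers `det • c` from `π X ι c`. -/
theorem apply_adjugate_mulVec [Module.Finite k M] (X : Module.End k M) {ρ : ℕ}
    (hX : Module.finrank k (LinearMap.range X) = ρ) (ι : (Fin ρ → k) →ₗ[k] M)
    (π : M →ₗ[k] (Fin ρ → k))
    (hG : (LinearMap.toMatrix' (π ∘ₗ X ∘ₗ ι)).det ≠ 0) (u : M) :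
    X (ι ((LinearMap.toMatrix' (π ∘ₗ X ∘ₗ ι)).adjugate.mulVec (π (X u)))) =
      (LinearMap.toMatrix' (π ∘ₗ X ∘ₗ ι)).det • X u := by
  set G := LinearMap.toMatrix' (π ∘ₗ X ∘ₗ ι) with hGdef
  have hmul (c : Fin ρ → k) : π (X (ι c)) = G.mulVec c := by
    rw [hGdef, LinearMap.toMatrix'_mulVec]; rfl
  have hinj : Function.Injective (X ∘ₗ ι) := by
    intro c c' h
    have h1 : G.mulVec c = G.mulVec c' := by
      rw [← hmul, ← hmul]
      exact congrArg π h
    exact Matrix.mulVec_injective_of_isUnit ((Matrix.isUnit_iff_isUnit_det _).2 hG.isUnit) h1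
  have hrange : LinearMap.range (X ∘ₗ ι) = LinearMap.range X := by
    refine Submodule.eq_of_le_of_finrank_eq (LinearMap.range_comp_le_range _ _) ?_
    rw [LinearMap.finrank_range_of_inj hinj, hX, Module.finrank_fin_fun]
  obtain ⟨c, hc⟩ : X u ∈ LinearMap.range (X ∘ₗ ι) := hrange ▸ LinearMap.mem_range_self X u
  have hc' : X (ι c) = X u := hc
  rw [← hc', hmul, Matrix.mulVec_mulVec, Matrix.adjugate_mul, Matrix.smul_mulVec,
    Matrix.one_mulVec, map_smul, map_smul]

theorem exists_section_retraction [Module.Finite k M] (X : Module.End k M) {ρ : ℕ}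
    (hX : Module.finrank k (LinearMap.range X) = ρ) :
    ∃ (ι : (Fin ρ → k) →ₗ[k] M) (π : M →ₗ[k] (Fin ρ → k)), π ∘ₗ X ∘ₗ ι = LinearMap.id := by
  let E : LinearMap.range X ≃ₗ[k] (Fin ρ → k) :=
    LinearEquiv.ofFinrankEq _ _ (by rw [hX, Module.finrank_fin_fun])
  obtain ⟨σ, hσ⟩ := X.rangeRestrict.exists_rightInverse_of_surjective X.range_rangeRestrict
  obtain ⟨τ, hτ⟩ := (LinearMap.range X).subtype.exists_leftInverse_of_injective
    (Submodule.ker_subtype _)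
  refine ⟨σ ∘ₗ E.symm.toLinearMap, E.toLinearMap ∘ₗ τ, LinearMap.ext fun c => ?_⟩
  have h1 : X (σ (E.symm c)) = (LinearMap.range X).subtype (E.symm c) :=
    congrArg Subtype.val (LinearMap.congr_fun hσ (E.symm c))
  have h2 : τ ((LinearMap.range X).subtype (E.symm c)) = E.symm c := LinearMap.congr_fun hτ _
  change E (τ (X (σ (E.symm c)))) = c
  rw [h1, h2, E.apply_symm_apply]

/-- Locally on the locus where the rank of `θ^l` is constant, `θ^l` has a polynomial generalized
inverse `B`, up to a denominator `D`. -/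
theorem exists_generalized_inverse [Module.Finite k M] (A : Fin r → Module.End k M) (l : ℕ) {ρ : ℕ}
    (hA : ∀ α : Fin r → k, α ≠ 0 → Module.finrank k (LinearMap.range (opAt A α ^ l)) = ρ)
    {α₀ : Fin r → k} (hα₀ : α₀ ≠ 0) :
    ∃ (D : S k r) (B : M →ₗ[k] S k r ⊗[k] M), MvPolynomial.eval α₀ D ≠ 0 ∧
      ∀ α : Fin r → k, α ≠ 0 → MvPolynomial.eval α D ≠ 0 → ∀ u : M,
        (opAt A α ^ l) (evalVec α (B ((opAt A α ^ l) u))) =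
          MvPolynomial.eval α D • (opAt A α ^ l) u := by
  obtain ⟨ι, π, h⟩ := exists_section_retraction _ (hA α₀ hα₀)
  -- `G` specializes at `α` to `π X_α^l ι`, which is the identity at `α₀`. The denominator is `det
  -- G`, and `B` below is `ι ∘ adj G ∘ π`.
  let G : Matrix (Fin ρ) (Fin ρ) (S k r) := Matrix.of fun a b =>
    contract (LinearMap.proj a ∘ₗ π) ((polyTheta A ^ l) (1 ⊗ₜ ι (Pi.single b 1)))
  have hG (α : Fin r → k) : (MvPolynomial.eval α).mapMatrix G =
      LinearMap.toMatrix' (π ∘ₗ (opAt A α ^ l) ∘ₗ ι) := by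
    ext a b
    simp [G, eval_contract, evalVec_polyTheta, LinearMap.toMatrix'_apply]
  let B : M →ₗ[k] S k r ⊗[k] M := ∑ a, ∑ b,
    (LinearMap.proj b ∘ₗ π).smulRight (G.adjugate a b • ((1 : S k r) ⊗ₜ[k] ι (Pi.single a 1)))
  have hB (α : Fin r → k) (v : M) : evalVec α (B v) =
      ι ((LinearMap.toMatrix' (π ∘ₗ (opAt A α ^ l) ∘ₗ ι)).adjugate.mulVec (π v)) := by
    rw [← hG, ← RingHom.map_adjugate, LinearMap.pi_apply_eq_sum_univ ι]
    simp only [B, LinearMap.sum_apply, map_sum, LinearMap.smulRight_apply, map_smul, evalVec_smul,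
      evalVec_tmul, map_one, one_smul, Matrix.mulVec, dotProduct, Finset.sum_smul]
    refine Finset.sum_congr rfl fun a _ => Finset.sum_congr rfl fun b _ => ?_
    have hs : (fun j => if a = j then (1 : k) else 0) = Pi.single a 1 := by
      ext j
      simp [Pi.single_apply, eq_comm]
    rw [smul_smul, mul_comm, hs]
    rfl
  refine ⟨G.det, B, ?_, fun α hα hD u => ?_⟩
  · rw [RingHom.map_det, hG, h]
    simp
  · rw [RingHom.map_det, hG] at hD ⊢
    rw [hB]
    exact apply_adjugate_mulVec _ (hA α hα) ι π hD u

theorem evalVec_liftBaseChange (B : M →ₗ[k] S k r ⊗[k] M') (α : Fin r → k) (t : S k r ⊗[k] M) :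
    evalVec α (B.liftBaseChange (S k r) t) = evalVec α (B (evalVec α t)) := by
  induction t with
  | zero => simp
  | add t t' h h' => simp [h, h']
  | tmul g m => simp [evalVec_smul]

/-- If the rank of `θ^l` is constant, each vector in the kernel of `X_β^l` is the value at `β`
of a polynomial vector in the kernel of `θ^l`. -/
theorem exists_polyTheta_eq_zero [Infinite k] [Module.Finite k M] (A : Fin r → Module.End k M)
    (l : ℕ) {ρ : ℕ}
    (hA : ∀ α : Fin r → k, α ≠ 0 → Module.finrank k (LinearMap.range (opAt A α ^ l)) = ρ)
    {β : Fin r → k} (hβ : β ≠ 0) {v : M} (hv : (opAt A β ^ l) v = 0) :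
    ∃ t : S k r ⊗[k] M, (polyTheta A ^ l) t = 0 ∧ evalVec β t = v := by
  obtain ⟨D, B, hD, h⟩ := exists_generalized_inverse A l hA hβ
  obtain ⟨j, -⟩ := Function.ne_iff.1 hβ
  -- From `θ^l B θ^l = D θ^l` where `D ≠ 0`, `θ^l` kills `t`. At `β` the second term vanishes,
  -- leaving `D(β) v` to be rescaled.
  let t : S k r ⊗[k] M := D ⊗ₜ v - B.liftBaseChange (S k r) ((polyTheta A ^ l) (1 ⊗ₜ v))
  have ht (α : Fin r → k) : evalVec α t =
      MvPolynomial.eval α D • v - evalVec α (B ((opAt A α ^ l) v)) := by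
    simp [t, evalVec_liftBaseChange, evalVec_polyTheta]
  refine ⟨(MvPolynomial.C (MvPolynomial.eval β D)⁻¹ : S k r) • t, ?_, ?_⟩
  · rw [map_smul]
    refine smul_eq_zero_of_right _ ?_
    refine eq_zero_of_evalVec (h := D) (by rintro rfl; simp at hD) j fun α hα hα' => ?_
    rw [evalVec_polyTheta, ht, map_sub, h α hα hα', map_smul, sub_self]
  · rw [evalVec_smul, ht, hv, map_zero, map_zero, sub_zero, MvPolynomial.eval_C,
      inv_smul_smul₀ hD]

/-- The homogeneous component of degree `e` of a polynomial vector. -/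
def componentVec (e : ℕ) : S k r ⊗[k] M →ₗ[k] S k r ⊗[k] M :=
  LinearMap.rTensor M (MvPolynomial.homogeneousComponent e)

@[simp] theorem componentVec_tmul (e : ℕ) (f : S k r) (m : M) :
    componentVec e (f ⊗ₜ m) = MvPolynomial.homogeneousComponent e f ⊗ₜ m := rfl

theorem componentVec_mem (e : ℕ) (t : S k r ⊗[k] M) : componentVec e t ∈ homPart M e := by
  induction t with
  | zero => simp
  | add t t' h h' => rw [map_add]; exact add_mem h h'
  | tmul f m =>
    exact ⟨⟨_, MvPolynomial.homogeneousComponent_mem e f⟩ ⊗ₜ m, by simp⟩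

theorem homogeneousComponent_X_mul (e : ℕ) (j : Fin r) (f : S k r) :
    MvPolynomial.homogeneousComponent (e + 1) (MvPolynomial.X j * f) =
      MvPolynomial.X j * MvPolynomial.homogeneousComponent e f := by
  have h (n : ℕ) (g : S k r) : (DirectSum.decompose (grading k r) g n : S k r) =
      MvPolynomial.homogeneousComponent n g := MvPolynomial.decomposition.decompose'_apply g n
  rw [add_comm, ← h, ← h]
  exact DirectSum.coe_decompose_mul_add_of_left_mem (grading k r)
    (MvPolynomial.isHomogeneous_X k j)

theorem homogeneousComponent_X_pow_mul (e l : ℕ) (j : Fin r) (f : S k r) :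
    MvPolynomial.homogeneousComponent (e + l) (MvPolynomial.X j ^ l * f) =
      MvPolynomial.X j ^ l * MvPolynomial.homogeneousComponent e f := by
  induction l with
  | zero => simp
  | succ l ih => rw [pow_succ', mul_assoc, ← add_assoc, homogeneousComponent_X_mul, ih, mul_assoc]

theorem componentVec_polyTheta_pow (A : Fin r → Module.End k M) (e l : ℕ) (t : S k r ⊗[k] M) :
    componentVec (e + l) ((polyTheta A ^ l) t) = (polyTheta A ^ l) (componentVec e t) := by
  have h1 (e : ℕ) (t : S k r ⊗[k] M) :
      componentVec (e + 1) (polyTheta A t) = polyTheta A (componentVec e t) := by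
    induction t with
    | zero => simp
    | add t t' h h' => rw [map_add, map_add, map_add, map_add, h, h']
    | tmul f m =>
      simp [polyTheta, TensorProduct.smul_tmul', homogeneousComponent_X_mul]
  induction l with
  | zero => rfl
  | succ l ih => rw [pow_succ', Module.End.mul_apply, Module.End.mul_apply, ← add_assoc, h1, ih]

/-- If the rank of `θ^l` is constant, vectors lying in the image of every `X_α^l` lie in the image
of `θ^l` up to a homogeneous denominator. -/
theorem exists_homogeneous_lift [IsAlgClosed k] [Module.Finite k M] (A : Fin r → Module.End k M)
    (l : ℕ) {ρ : ℕ}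
    (hA : ∀ α : Fin r → k, α ≠ 0 → Module.finrank k (LinearMap.range (opAt A α ^ l)) = ρ)
    (x : ProjectiveSpectrum (grading k r)) :
    ∃ (e : ℕ) (D : S k r) (b : M →ₗ[k] S k r ⊗[k] M), D ∈ grading k r (e + l) ∧
      D ∉ x.asHomogeneousIdeal ∧ (∀ m, b m ∈ homPart M e) ∧
      ∀ m, (∀ α : Fin r → k, α ≠ 0 → m ∈ LinearMap.range (opAt A α ^ l)) →
        (polyTheta A ^ l) (b m) = D ⊗ₜ m := by
  have : Infinite k := IsAlgClosed.instInfinite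
  obtain ⟨α₀, hα₀, hx⟩ := exists_point x
  obtain ⟨j, hj⟩ := exists_X_notMem x
  obtain ⟨D, B, hD, h⟩ := exists_generalized_inverse A l hA hα₀
  -- `D` need not be homogeneous, but some component of it avoids the prime of `x`.
  obtain ⟨e, he⟩ : ∃ e, MvPolynomial.homogeneousComponent e D ∉ x.asHomogeneousIdeal := by
    by_contra! hc
    refine hx D hD ?_
    rw [← MvPolynomial.sum_homogeneousComponent D]
    exact x.asHomogeneousIdeal.toIdeal.sum_mem fun e _ => hc e
  -- Since `θ^l` raises degrees by `l`, the degree `e` part of `D` would call for a lift of degree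
  -- `e - l`, possibly negative. Multiplying by `X_j^l` avoids this.
  refine ⟨e, MvPolynomial.X j ^ l * MvPolynomial.homogeneousComponent e D,
    componentVec e ∘ₗ (LinearMap.lsmul (S k r) _ (MvPolynomial.X j ^ l)).restrictScalars k ∘ₗ B,
    ?_, ?_, fun m => componentVec_mem _ _, fun m hm => ?_⟩
  · rw [← homogeneousComponent_X_pow_mul]
    exact MvPolynomial.homogeneousComponent_mem _ _
  · exact x.asHomogeneousIdeal.toIdeal.primeCompl.mul_mem
      (x.asHomogeneousIdeal.toIdeal.primeCompl.pow_mem hj l) he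
  · have h1 : (polyTheta A ^ l) (B m) = D ⊗ₜ m := by
      rw [← sub_eq_zero]
      refine eq_zero_of_evalVec (h := D) (by rintro rfl; simp at hD) j fun α hα hα' => ?_
      obtain ⟨u, rfl⟩ := hm α hα
      rw [map_sub, evalVec_polyTheta, h α hα hα', evalVec_tmul, sub_self]
    change (polyTheta A ^ l) (componentVec e ((MvPolynomial.X j ^ l : S k r) • B m)) = _
    rw [← componentVec_polyTheta_pow, map_smul, h1, TensorProduct.smul_tmul', smul_eq_mul,
      componentVec_tmul, homogeneousComponent_X_pow_mul]

theorem liftBaseChange_mem_homPart {B : M →ₗ[k] S k r ⊗[k] M'} {a e : ℕ}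
    (hB : ∀ m, B m ∈ homPart M' e) {t : S k r ⊗[k] M} (ht : t ∈ homPart M a) :
    B.liftBaseChange (S k r) t ∈ homPart M' (a + e) := by
  obtain ⟨t, rfl⟩ := ht
  induction t with
  | zero => simp
  | add t t' h h' => rw [map_add, map_add]; exact add_mem h h'
  | tmul c m => simpa using smul_mem_homPart c.2 (hB m)

/-- The local form of the inclusion of `J ⊗ 𝒪(n')` in the image of `θ^l`. -/
theorem exists_local_preimage [IsAlgClosed k] [Module.Finite k M] (A : Fin r → Module.End k M)
    (l : ℕ) {ρ : ℕ}
    (hA : ∀ α : Fin r → k, α ≠ 0 → Module.finrank k (LinearMap.range (opAt A α ^ l)) = ρ)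
    (f : M' →ₗ[k] M)
    (hf : ∀ (m : M') (α : Fin r → k), α ≠ 0 → f m ∈ LinearMap.range (opAt A α ^ l))
    {n n' : ℤ} (hn : n + l = n') {U : Opens (PTop k r)} {s : ∀ x : U, Fib M' x.1}
    (hs : (locallyFraction M' n').pred s) (x : U) :
    ∃ (V : Opens (PTop k r)) (_ : x.1 ∈ V) (i : V ⟶ U) (w : ∀ y : V, Fib M y.1),
      (locallyFraction M n).pred w ∧
        ∀ y : V, (fibTheta A y.1 ^ l) (w y) = f.baseChange (Loc y.1) (s (i y)) := by
  obtain ⟨V, hV, i, a, b, t, g, hab, ht, hg, h⟩ := hs x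
  obtain ⟨e, D, B, hD, hDx, hBe, hB⟩ := exists_homogeneous_lift A l hA x.1
  let B' := (B ∘ₗ f).liftBaseChange (S k r)
  have hB' (t : S k r ⊗[k] M') : (polyTheta A ^ l) (B' t) = D • f.baseChange (S k r) t := by
    induction t with
    | zero => simp
    | add t t' h h' => rw [map_add, map_add, map_add, smul_add, h, h']
    | tmul c m =>
      simp [B', hB _ (hf m), TensorProduct.smul_tmul', mul_comm]
  have hBt : B' t ∈ homPart M (a + e) := liftBaseChange_mem_homPart (fun m => hBe (f m)) ht
  have h0 (y : ProjectiveSpectrum (grading k r)) :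
      (fibTheta A y ^ l) (toFib M y (B' t)) = D • f.baseChange (Loc y) (toFib M' y t) := by
    rw [← toFib_polyTheta_pow, hB', map_smul, toFib_baseChange]
  have hmem (y : (V ⊓ ProjectiveSpectrum.basicOpen _ D : Opens (PTop k r))) :
      D * g ∈ y.1.asHomogeneousIdeal.toIdeal.primeCompl :=
    y.1.asHomogeneousIdeal.toIdeal.primeCompl.mul_mem y.2.2 (h ⟨y.1, y.2.1⟩).1
  -- With `s = t / g`, the fraction `B' t / (D g)` has degree `(a + e) - (e + l + b) = n`, and `θ^l`
  -- sends it to `D f(t) / (D g) = f(s)`.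
  let w (y : (V ⊓ ProjectiveSpectrum.basicOpen _ D : Opens (PTop k r))) : Fib M y.1 :=
    IsLocalization.mk' (Loc y.1) (1 : S k r) ⟨D * g, hmem y⟩ • toFib M y.1 (B' t)
  have hw (y) : (D * g) • w y = toFib M y.1 (B' t) := by
    rw [← algebraMap_smul (Loc y.1), smul_smul, mul_comm,
      IsLocalization.mk'_spec (Loc y.1) (1 : S k r) ⟨D * g, hmem y⟩, map_one, one_smul]
  refine ⟨V ⊓ ProjectiveSpectrum.basicOpen _ D, ⟨hV, hDx⟩, Opens.infLELeft _ _ ≫ i, w,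
    fun y => ⟨_, y.2, 𝟙 _, a + e, (e + l) + b, B' t, D * g, by push_cast; omega, hBt,
      SetLike.mul_mem_graded hD hg, fun z => ⟨hmem z, hw z⟩⟩, fun y => ?_⟩
  refine sub_eq_zero.1 (eq_zero_of_smul_eq_zero (hmem y) ?_)
  have h1 : (D * g) • (fibTheta A y.1 ^ l) (w y) =
      D • f.baseChange (Loc y.1) (toFib M' y.1 t) := by
    rw [← LinearMap.map_smul_of_tower, hw]
    exact h0 y.1
  have h2 (z : Fib M' y.1) : (D * g) • f.baseChange (Loc y.1) z =
      D • f.baseChange (Loc y.1) (g • z) := by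
    rw [mul_smul, LinearMap.map_smul_of_tower]
  rw [smul_sub, sub_eq_zero, h1]
  exact (congrArg (fun z => D • f.baseChange (Loc y.1) z) (h ⟨y.1, y.2.1⟩).2.symm).trans
    (h2 _).symm

end ConstantRank

/-! ### Submodules and quotients that leave the subquotient sheaves unchanged. -/

section Subquotients

variable {k : Type u} [Field k] {r : ℕ}
variable {M M' : Type u} [AddCommGroup M] [Module k M] [AddCommGroup M'] [Module k M']

/-- On each `V` the section becomes `g w`, which `c` kills, and sections of the sheaf `Z` are
determined locally. -/
theorem app_comp_eq_zero_of_locally {X Y Z : (PSpace k r).Modules} (g : X ⟶ Y) (c : Y ⟶ Z)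
    (hgc : g ≫ c = 0) (U : (PSpace k r).Opens) (σ : Y.presheaf.obj (.op U))
    (h : ∀ x : U, ∃ (V : (PSpace k r).Opens) (_ : x.1 ∈ V) (i : V ⟶ U)
      (w : X.presheaf.obj (.op V)), g.app V w = Y.presheaf.map i.op σ) :
    c.app U σ = 0 := by
  choose V hV i w hw using h
  let F : TopCat.Sheaf Ab.{u} (PSpace k r) := ⟨Z.presheaf, Z.isSheaf⟩
  refine TopCat.Sheaf.eq_of_locally_eq' F V U i (fun x hx => ?_) (c.app U σ) 0 fun x => ?_
  · exact Opens.mem_iSup.2 ⟨⟨x, hx⟩, hV ⟨x, hx⟩⟩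
  · have h1 : Z.presheaf.map (i x).op (c.app U σ) = c.app (V x) (Y.presheaf.map (i x).op σ) :=
      (ConcreteCategory.congr_hom (c.mapPresheaf.naturality (i x).op) σ).symm
    have h2 : c.app (V x) (g.app (V x) (w x)) = 0 := by
      have := congrArg (fun f : X ⟶ Z => f.app (V x) (w x)) hgc
      exact this
    refine h1.trans ?_
    rw [← hw, h2, map_zero]

/-- Sheaf form of the local lifting: vanishing in the cokernel expresses that the twist of `f` lands
in `Im θ^l`. -/
theorem twistMap_comp_cokernel [IsAlgClosed k] [Module.Finite k M] (A : Fin r → Module.End k M)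
    (l : ℕ) {ρ : ℕ}
    (hA : ∀ α : Fin r → k, α ≠ 0 → Module.finrank k (LinearMap.range (opAt A α ^ l)) = ρ)
    (f : M' →ₗ[k] M)
    (hf : ∀ (m : M') (α : Fin r → k), α ≠ 0 → f m ∈ LinearMap.range (opAt A α ^ l))
    {n n' : ℤ} (hn : n + l = n') :
    twistMap f n' ≫ cokernel.π (thetaPow A l n n' hn) = 0 := by
  refine AlgebraicGeometry.Scheme.Modules.hom_ext _ _ fun U => ?_
  refine ConcreteCategory.hom_ext _ _ fun s => ?_
  refine app_comp_eq_zero_of_locally (thetaPow A l n n' hn) _ (cokernel.condition _) U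
    ((twistMap f n').app U s) fun x => ?_
  obtain ⟨V, hV, i, w, hw, h⟩ := exists_local_preimage A l hA f hf hn
    (show (locallyFraction M' n').pred s.1 from s.2) x
  exact ⟨V, hV, i, ⟨w, hw⟩, Subtype.ext (funext h)⟩

theorem im_antitone (A : Fin r → Module.End k M) (i : ℕ) :
    (thetaOperator A).ker ⊓ (thetaOperator A).im (i + 1) ≤
      (thetaOperator A).ker ⊓ (thetaOperator A).im i :=
  inf_le_inf_left _ (imTheta_antitone A (Nat.le_succ i))

/-- Passing to the quotient by a subspace contained in the image of `X_α^{i+1}` for all `α` does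
not change the `i`th subquotient, if the rank of `X_α^{i+1}` is constant. -/
theorem nonempty_subquotient_iso_of_surjective [IsAlgClosed k] [Module.Finite k M]
    {A : Fin r → Module.End k M} {A' : Fin r → Module.End k M'} (q : M →ₗ[k] M')
    (hq : Function.Surjective q) (hqA : ∀ j, q ∘ₗ A j = A' j ∘ₗ q) {i : ℕ} (hi : 1 ≤ i) {ρ : ℕ}
    (hA : ∀ α : Fin r → k, α ≠ 0 → Module.finrank k (LinearMap.range (opAt A α ^ (i + 1))) = ρ)
    (hker : ∀ α : Fin r → k, α ≠ 0 → LinearMap.ker q ≤ LinearMap.range (opAt A α ^ (i + 1))) :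
    Nonempty (subquotient A i ≅ subquotient A' i) := by
  -- From here `i` is one less than the index of the sheaf, so `i + 2` is the exponent in `hA` and
  -- `hker`.
  obtain ⟨i, rfl⟩ := Nat.exists_eq_add_of_le' hi
  have (n : ℤ) : Epi ((thetaHom q hqA).app n) := epi_twistMap hq n
  refine GradedOperator.nonempty_iso_of_epi (thetaHom q hqA) i (im_antitone A i) (im_antitone A' i)
    fun n n' hn _ x hx => ?_
  obtain ⟨w, rfl⟩ := exists_comp_twistMap_eq (f := (LinearMap.ker q).subtype)
    (Submodule.subtype_injective _) hq (LinearMap.exact_subtype_ker_map q) n' x hx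
  refine (CokernelCofork.IsColimit.comp_π_eq_zero_iff_up_to_refinements
    (cokernelIsCokernel (thetaPow A (i + 2) n n' hn)) _).1 ?_
  have h0 := twistMap_comp_cokernel A (i + 2) hA (LinearMap.ker q).subtype
    (fun m α hα => hker α hα m.2) hn
  exact (Category.assoc _ _ _).trans ((congrArg (w ≫ ·) h0).trans comp_zero)

/-- A common denominator is invertible in the fibre, and `S ⊗ M` embeds in it, so the claim reduces
to polynomial vectors. -/
theorem baseChange_eq_zero_of_fibTheta_pow {A : Fin r → Module.End k M} {j : ℕ} (q : M →ₗ[k] M')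
    (h : ∀ t : S k r ⊗[k] M, (polyTheta A ^ j) t = 0 → ∀ d, q (coeffVec d t) = 0)
    (x : ProjectiveSpectrum (grading k r)) {y : Fib M x} (hy : (fibTheta A x ^ j) y = 0) :
    q.baseChange (Loc x) y = 0 := by
  obtain ⟨D, t, hD, ht⟩ := exists_smul_eq_toFib x y
  have h0 : (polyTheta A ^ j) t = 0 := by
    refine toFib_injective x ?_
    rw [toFib_polyTheta_pow, ← ht, LinearMap.map_smul_of_tower, hy, smul_zero, map_zero]
  have h1 : q.baseChange (S k r) t = 0 :=
    eq_zero_of_coeffVec fun d => by rw [coeffVec_baseChange, h t h0]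
  refine eq_zero_of_smul_eq_zero hD ?_
  rw [← LinearMap.map_smul_of_tower, ht, ← toFib_baseChange, h1, map_zero]

/-- Passing to a subspace containing the kernels of `θ^j` for `j ≤ i + 1` does not change the `i`th
subquotient. -/
theorem nonempty_subquotient_iso_of_injective
    {A : Fin r → Module.End k M} {A' : Fin r → Module.End k M'} (f : M →ₗ[k] M')
    (hf : Function.Injective f) (hfA : ∀ j, f ∘ₗ A j = A' j ∘ₗ f) {i : ℕ} (hi : 1 ≤ i)
    (hker : 0 < r → ∀ j ≤ i + 1, ∀ t : S k r ⊗[k] M', (polyTheta A' ^ j) t = 0 →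
      ∀ d, coeffVec d t ∈ LinearMap.range f) :
    Nonempty (subquotient A i ≅ subquotient A' i) := by
  obtain ⟨i, rfl⟩ := Nat.exists_eq_add_of_le' hi
  have (n : ℤ) : Mono ((thetaHom f hfA).app n) := mono_twistMap hf n
  refine GradedOperator.nonempty_iso_of_mono (thetaHom f hfA) i (im_antitone A i)
    (im_antitone A' i) fun j n n' hn B z hj hz => ?_
  refine exists_comp_twistMap_eq (g := (LinearMap.range f).mkQ) hf (Submodule.mkQ_surjective _)
    (LinearMap.exact_map_mkQ_range f) n z ?_
  refine AlgebraicGeometry.Scheme.Modules.hom_ext _ _ fun U => ?_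
  refine ConcreteCategory.hom_ext _ _ fun b => Subtype.ext <| funext fun x => ?_
  have hz' : (fibTheta A' x.1 ^ j) ((z.app U b).1 x) = 0 :=
    congrArg (fun s => s.1 x) (congrArg (fun g : B ⟶ twist M' n' => g.app U b) hz)
  change (LinearMap.range f).mkQ.baseChange (Loc x.1) ((z.app U b).1 x) = 0
  -- A point of `Proj` forces `r > 0`. For `r = 0` the empty set is dense in `ℙ(k)` and the generic
  -- kernel is zero, hence the guard in `hker`.
  obtain ⟨m, -⟩ := exists_X_notMem x.1
  exact baseChange_eq_zero_of_fibTheta_pow _ (fun t ht d => (Submodule.Quotient.mk_eq_zero _).2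
    (hker (Nat.zero_lt_of_lt m.2) j hj t ht d)) x.1 hz'

end Subquotients

/-! ### Generic kernels and images of `kE`-modules. -/

section ElementaryAbelian

open scoped LinearAlgebra.Projectivization

variable {p : ℕ} {k : Type u} [Field k] {r : ℕ} {E : Type v} [CommGroup E]
  (e : E ≃* Multiplicative (Fin r → ZMod p))
variable (M : Type u) [AddCommGroup M] [Module k M] [Module (MonoidAlgebra k E) M]
  [IsScalarTower k (MonoidAlgebra k E) M]

variable (k) in
/-- The operators `Xⱼ` on `M`. -/
def ops (j : Fin r) : Module.End k M := Algebra.lsmul k k M (genX k e j)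

variable {M}

theorem opAt_ops (α : Fin r → k) :
    opAt (ops k e M) α = Algebra.lsmul k k M (XElt e α) := by
  simp only [opAt, ops, XElt, map_sum, map_smul]

theorem opAt_ops_pow (α : Fin r → k) (l : ℕ) (m : M) :
    (opAt (ops k e M) α ^ l) m = XElt e α ^ l • m := by
  rw [opAt_ops, ← map_pow]
  rfl

/-- For `α` in a dense open `U`, the value `t(α)` lies in `Ker X_α^j ⊆ Ker X_α^n`, a summand of
`kernelSum`. Density of `U` passes this from values to coefficients. -/
theorem coeffVec_mem_genericKernel [Infinite k] (hr : 0 < r) {j n : ℕ} (hj : j ≤ n)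
    {t : S k r ⊗[k] M} (ht : (polyTheta (ops k e M) ^ j) t = 0) (d : Fin r →₀ ℕ) :
    coeffVec d t ∈ genericKernel k e M n := by
  simp only [genericKernel, Submodule.mem_iInf]
  intro U hU hUd
  have : Nonempty (ℙ k (Fin r → k)) := by
    have : Nonempty (Fin r) := ⟨⟨0, hr⟩⟩
    infer_instance
  have hne : U.Nonempty := @Dense.nonempty _ (zariski k r) _ _ hUd
  refine coeffVec_mem_of_isOpen (W := (kernelSum e M n U).restrictScalars k) hU hne
    (fun α hα hαU => ?_) d
  have h0 : XElt e α ^ n • evalVec α t = 0 := by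
    rw [← Nat.sub_add_cancel hj, pow_add, mul_smul, ← opAt_ops_pow e α j, ← evalVec_polyTheta, ht,
      map_zero, smul_zero]
  exact Submodule.mem_iSup_of_mem α (Submodule.mem_iSup_of_mem hα
    (Submodule.mem_iSup_of_mem hαU h0))

/-- If the rank of `X_α^l` is constant, its kernels are contained in the generic kernel. -/
theorem mem_genericKernel [Infinite k] [Module.Finite k M] {l n ρ : ℕ} (hl : l ≤ n)
    (hρ : ∀ α : Fin r → k, α ≠ 0 →
      Module.finrank k (LinearMap.range (opAt (ops k e M) α ^ l)) = ρ)
    {β : Fin r → k} (hβ : β ≠ 0) {m : M} (hm : XElt e β ^ l • m = 0) :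
    m ∈ genericKernel k e M n := by
  obtain ⟨j, -⟩ := Function.ne_iff.1 hβ
  -- A given `U` may miss `β`, so `m` is extended to a polynomial vector killed by `θ^l`. Its
  -- coefficients lie in the generic kernel, hence so does its value at `β`.
  obtain ⟨t, ht, rfl⟩ := exists_polyTheta_eq_zero _ l hρ hβ ((opAt_ops_pow e β l m).trans hm)
  exact evalVec_mem_of_coeffVec (W := (genericKernel k e M n).restrictScalars k)
    (coeffVec_mem_genericKernel e (Nat.zero_lt_of_lt j.2) hl ht) β

/-- `X_α^l` has the same kernel on `𝔎ⁿ(M)` as on `M`, so its rank drops by the codimension of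
`𝔎ⁿ(M)`, whatever `α` is. -/
theorem finrank_range_genericKernel [Infinite k] [Module.Finite k M] {l n ρ : ℕ} (hl : l ≤ n)
    (hρ : ∀ α : Fin r → k, α ≠ 0 →
      Module.finrank k (LinearMap.range (opAt (ops k e M) α ^ l)) = ρ) :
    ∃ ρ' : ℕ, ∀ α : Fin r → k, α ≠ 0 → Module.finrank k
      (LinearMap.range (opAt (ops k e (genericKernel k e M n)) α ^ l)) = ρ' := by
  let ι : genericKernel k e M n →ₗ[k] M := (genericKernel k e M n).subtype.restrictScalars k
  have hι : Function.Injective ι := Subtype.val_injective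
  have : Module.Finite k (genericKernel k e M n) := Module.Finite.of_injective ι hι
  refine ⟨Module.finrank k (genericKernel k e M n) + ρ - Module.finrank k M, fun α hα => ?_⟩
  have hker : (LinearMap.ker (opAt (ops k e (genericKernel k e M n)) α ^ l)).map ι =
      LinearMap.ker (opAt (ops k e M) α ^ l) := by
    ext m
    constructor
    · rintro ⟨m, hm, rfl⟩
      have h1 := congrArg ι hm
      rw [opAt_ops_pow, map_zero] at h1
      exact (opAt_ops_pow e α l _).trans h1
    · intro hm
      have hm' : XElt e α ^ l • m = 0 := (opAt_ops_pow e α l m).symm.trans hm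
      exact ⟨⟨m, mem_genericKernel e hl hρ hα hm'⟩,
        (opAt_ops_pow e α l _).trans (Subtype.ext hm'), rfl⟩
  have h1 := LinearMap.finrank_range_add_finrank_ker (opAt (ops k e M) α ^ l)
  have h2 := LinearMap.finrank_range_add_finrank_ker
    (opAt (ops k e (genericKernel k e M n)) α ^ l)
  rw [hρ α hα, ← hker, ← (Submodule.equivMapOfInjective ι hι _).finrank_eq] at h1
  omega

/-- Matching the two Jordan bases gives an automorphism conjugating `f` to `g`, hence `f ^ l` to `g
^ l`. -/
theorem HasJordanType.finrank_range_pow_eq {M : Type*} [AddCommGroup M] [Module k M]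
    {f g : Module.End k M} {a : Fin p → ℕ} (hf : HasJordanType f a) (hg : HasJordanType g a)
    (l : ℕ) : Module.finrank k (LinearMap.range (f ^ l)) =
      Module.finrank k (LinearMap.range (g ^ l)) := by
  obtain ⟨b, hb⟩ := hf
  obtain ⟨c, hc⟩ := hg
  let φ : M ≃ₗ[k] M := b.equiv c (Equiv.refl _)
  have h1 : φ.toLinearMap ∘ₗ f = g ∘ₗ φ.toLinearMap := by
    refine b.ext fun ⟨j, x, s⟩ => ?_
    simp only [LinearMap.comp_apply, LinearEquiv.coe_coe, hb, φ, Module.Basis.equiv_apply,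
      Equiv.refl_apply, hc]
    split_ifs <;> simp
  have h2 : φ.toLinearMap ∘ₗ (f ^ l) = (g ^ l) ∘ₗ φ.toLinearMap := by
    induction l with
    | zero => rfl
    | succ l ih =>
      rw [pow_succ, pow_succ, Module.End.mul_eq_comp, Module.End.mul_eq_comp, ← LinearMap.comp_assoc,
        ih, LinearMap.comp_assoc, h1, LinearMap.comp_assoc]
  have h3 : (LinearMap.range (f ^ l)).map φ.toLinearMap = LinearMap.range (g ^ l) := by
    rw [← LinearMap.range_comp, h2, LinearMap.range_comp, LinearEquiv.range, Submodule.map_top]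
  rw [← h3]
  exact (LinearEquiv.finrank_map_eq φ _).symm

theorem HasConstantJordanType.exists_finrank_range_eq (hM : HasConstantJordanType k e M) (l : ℕ) :
    ∃ ρ : ℕ, ∀ α : Fin r → k, α ≠ 0 →
      Module.finrank k (LinearMap.range (opAt (ops k e M) α ^ l)) = ρ := by
  obtain ⟨a, ha⟩ := hM
  by_cases h : ∃ α : Fin r → k, α ≠ 0
  · obtain ⟨β, hβ⟩ := h
    refine ⟨Module.finrank k (LinearMap.range (opAt (ops k e M) β ^ l)), fun α hα => ?_⟩
    rw [opAt_ops, opAt_ops]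
    exact (ha α hα).finrank_range_pow_eq (ha β hβ) l
  · exact ⟨0, fun α hα => (h ⟨α, hα⟩).elim⟩

theorem comp_ops {M' : Type u} [AddCommGroup M'] [Module k M'] [Module (MonoidAlgebra k E) M']
    [IsScalarTower k (MonoidAlgebra k E) M'] (f : M →ₗ[MonoidAlgebra k E] M') (j : Fin r) :
    f.restrictScalars k ∘ₗ ops k e M j = ops k e M' j ∘ₗ f.restrictScalars k :=
  LinearMap.ext fun m => f.map_smul (genX k e j) m

/-- `𝓕ᵢ(𝔎ⁿ(M)) ≅ 𝓕ᵢ(M)` for `i < n`. -/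
theorem nonempty_bundleF_genericKernel_iso [Infinite k] {i n : ℕ} (hi : 1 ≤ i) (hn : i + 1 ≤ n) :
    Nonempty (bundleF k e (genericKernel k e M n) i ≅ bundleF k e M i) := by
  refine nonempty_subquotient_iso_of_injective
    ((genericKernel k e M n).subtype.restrictScalars k) Subtype.val_injective
    (comp_ops e (genericKernel k e M n).subtype) hi
    fun hr j hj t ht d => ?_
  exact ⟨⟨_, coeffVec_mem_genericKernel e hr (hj.trans hn) ht d⟩, rfl⟩

theorem genericImage_le {l m : ℕ} (hl : l ≤ m) {α : Fin r → k} (hα : α ≠ 0) {x : M}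
    (hx : x ∈ genericImage k e M m) : x ∈ LinearMap.range (opAt (ops k e M) α ^ l) := by
  simp only [genericImage, Submodule.mem_iInf] at hx
  obtain ⟨y, rfl⟩ := hx α hα
  refine ⟨XElt e α ^ (m - l) • y, ?_⟩
  rw [opAt_ops_pow, smul_smul, ← pow_add, Nat.add_sub_cancel' hl]
  rfl

/-- `𝓕ᵢ(M) ≅ 𝓕ᵢ(M / 𝔍ᵐ(M))` for `i < m`, if the rank of `X_α^{i+1}` is constant. -/
theorem nonempty_bundleF_iso_quotient [IsAlgClosed k] [Module.Finite k M] {i m : ℕ} (hi : 1 ≤ i)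
    (hm : i + 1 ≤ m) {ρ : ℕ} (hρ : ∀ α : Fin r → k, α ≠ 0 →
      Module.finrank k (LinearMap.range (opAt (ops k e M) α ^ (i + 1))) = ρ) :
    Nonempty (bundleF k e M i ≅ bundleF k e (M ⧸ genericImage k e M m) i) := by
  have hq : Function.Surjective ((genericImage k e M m).mkQ.restrictScalars k) :=
    Quotient.mk_surjective
  refine nonempty_subquotient_iso_of_surjective
    ((genericImage k e M m).mkQ.restrictScalars k) hq
    (comp_ops e (genericImage k e M m).mkQ) hi
    hρ fun α hα x hx => ?_
  exact genericImage_le e hm hα ((Submodule.Quotient.mk_eq_zero _).1 hx)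

/-- Both isomorphisms for a module such that the rank of `X_α^{i+1}` is constant. -/
theorem nonempty_bundleF_iso_of_constant_rank [IsAlgClosed k] [Module.Finite k M] {i n m : ℕ}
    (hi : 1 ≤ i) (hn : i + 1 ≤ n) (hm : i + 1 ≤ m) {ρ : ℕ} (hρ : ∀ α : Fin r → k, α ≠ 0 →
      Module.finrank k (LinearMap.range (opAt (ops k e M) α ^ (i + 1))) = ρ) :
    Nonempty (bundleF k e M i ≅ bundleF k e
      (genericKernel k e M n ⧸ genericImage k e (genericKernel k e M n) m) i) ∧
    Nonempty (bundleF k e M i ≅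
      bundleF k e (genericKernel k e (M ⧸ genericImage k e M m) n) i) := by
  have : Infinite k := IsAlgClosed.instInfinite
  have : Module.Finite k (genericKernel k e M n) := Module.Finite.of_injective
    ((genericKernel k e M n).subtype.restrictScalars k) Subtype.val_injective
  -- The quotient reduction is applied to `𝔎ⁿ(M)` as well as to `M`, so constant rank is needed on
  -- both. The kernel reduction needs no rank hypothesis and applies directly to `M / 𝔍ᵐ(M)`.
  obtain ⟨ρ', hρ'⟩ := finrank_range_genericKernel e hn hρ
  obtain ⟨φ⟩ := nonempty_bundleF_genericKernel_iso (k := k) (M := M) e hi hn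
  obtain ⟨ψ⟩ := nonempty_bundleF_iso_quotient e hi hm hρ'
  obtain ⟨χ⟩ := nonempty_bundleF_iso_quotient e hi hm hρ
  obtain ⟨ω⟩ := nonempty_bundleF_genericKernel_iso (k := k) (M := M ⧸ genericImage k e M m) e hi hn
  exact ⟨⟨φ.symm ≪≫ ψ⟩, ⟨χ ≪≫ ω.symm⟩⟩

end ElementaryAbelian

end GenericKernels

end

theorem mainTheorem6 {p : ℕ} [Fact p.Prime] {k : Type u} [Field k] [IsAlgClosed k] [CharP k p]
    {r : ℕ} {E : Type v} [CommGroup E] (e : E ≃* Multiplicative (Fin r → ZMod p))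
    (M : Type u) [AddCommGroup M] [Module k M] [Module (MonoidAlgebra k E) M]
    [IsScalarTower k (MonoidAlgebra k E) M] [Module.Finite k M]
    (hM : GenericKernels.HasConstantJordanType k e M) (i : ℕ) (hi : 1 ≤ i) (hip : i ≤ p) :
    (∀ n m : ℕ, 0 < n → 0 < m → i ≤ min (n - 1) (m - 1) →
      Nonempty (GenericKernels.bundleF k e M i ≅
        GenericKernels.bundleF k e (GenericKernels.genericKernel k e M n ⧸
          GenericKernels.genericImage k e (GenericKernels.genericKernel k e M n) m) i) ∧
      Nonempty (GenericKernels.bundleF k e M i ≅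
        GenericKernels.bundleF k e (GenericKernels.genericKernel k e
          (M ⧸ GenericKernels.genericImage k e M m) n) i)) ∧
    Nonempty (GenericKernels.bundleF k e M i ≅
      GenericKernels.bundleF k e (GenericKernels.genericKernel k e M (i + 1) ⧸
        GenericKernels.genericImage k e (GenericKernels.genericKernel k e M (i + 1)) (i + 1)) i) ∧
    Nonempty (GenericKernels.bundleF k e M i ≅
      GenericKernels.bundleF k e (GenericKernels.genericKernel k e
        (M ⧸ GenericKernels.genericImage k e M (i + 1)) (i + 1)) i) := by
  obtain ⟨ρ, hρ⟩ := hM.exists_finrank_range_eq e (i + 1)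
  refine ⟨fun n m hn hm h => ?_, ?_⟩
  · exact GenericKernels.nonempty_bundleF_iso_of_constant_rank e hi (by omega) (by omega) hρ
  · exact GenericKernels.nonempty_bundleF_iso_of_constant_rank e hi le_rfl le_rfl hρ
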